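/- Work over $\mathbb C$. Let $k,h_1,h_2$ be integers with $h_1,h_2<k$, and let $(\alpha_1,\alpha_2)$ be a profile, that is, $1\le\alpha_j\le h_j$ for $j=1,2$ and $\alpha_1+\alpha_2=k+1$. Let $\mathfrak W_0$ be the set of pairs $(M_1,M_2)$, where $M_j$ is a complex $(k+1)\times(h_j+1)$ matrix of rank $h_j+1$ and $\ker M_1^T\cap\ker M_2^T=0$; thus $M_1^T$ and $M_2^T$ are the matrices of two projections $\mathbb P^k\dashrightarrow\mathbb P^{h_1}$, $\mathbb P^k\dashrightarrow\mathbb P^{h_2}$ with disjoint centres. Let $\mathfrak Q_0\subset G(k+1,h_1+h_2+2)\subset\mathbb P\big(\bigwedge^{k+1}(\mathbb C^{h_1+1}\oplus\mathbb C^{h_2+1})\big)$ be the open subset, in the Plücker embedding, of the row spaces of the matrices $[M_1|M_2]$ with $(M_1,M_2)\in\mathfrak W_0$. Let $\mathcal X_{(\alpha_1,\alpha_2)}$, the variety of bifocal Grassmann tensors with profile $(\alpha_1,\alpha_2)$, be the Zariski closure of the image of $\mathfrak Q_0$ under the linear projection onto $\mathbb P\big(\bigwedge^{\alpha_1}\mathbb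 C^{h_1+1}\otimes\bigwedge^{\alpha_2}\mathbb C^{h_2+1}\big)$, which keeps those maximal minors of $[M_1|M_2]$ that use $\alpha_1$ columns of $M_1$ and $\alpha_2$ columns of $M_2$; the image of the point given by $(M_1,M_2)$ is its bifocal Grassmann tensor. Then $\mathcal X_{(\alpha_1,\alpha_2)}$ is birational to a homogeneous space for $GL(h_1+1)\times GL(h_2+1)$, that is, to a variety with a transitive algebraic action of this group. More precisely, the homogeneous space can be taken to be a non-empty Zariski-open subset of $\mathcal X_{(\alpha_1,\alpha_2)}$ which contains the bifocal Grassmann tensors of all $(M_1,M_2)\in\mathfrak W_0$, with the action induced by $(M_1,M_2)\cdot(H_1,H_2)=(M_1H_1,M_2H_2)$. -/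

import Mathlib

open scoped LinearAlgebra.Projectivization MatrixGroups

namespace Bifocal

noncomputable section

/-! ### Classical complex quasi-projective varieties -/

/-- The Zariski topology on the projective space of lines in `ℂ^ι`: the complements of
hypersurfaces form a basis of it. -/
instance zariskiTopology (ι : Type*) : TopologicalSpace (ℙ ℂ (ι → ℂ)) :=
  TopologicalSpace.generateFrom
    {U | ∃ (d : ℕ) (f : MvPolynomial ι ℂ), f.IsHomogeneous d ∧
      U = {p : ℙ ℂ (ι → ℂ) | MvPolynomial.eval p.rep f ≠ 0}}

/-- A (quasi-projective, irreducible, in particular non-empty) variety. -/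
def IsVariety {ι : Type*} (X : Set (ℙ ℂ (ι → ℂ))) : Prop :=
  IsIrreducible X ∧ IsLocallyClosed X

/-- `Y` is a Zariski-open subset of the variety `X`. -/
def IsOpenSubsetOf {ι : Type*} (Y X : Set (ℙ ℂ (ι → ℂ))) : Prop :=
  ∃ U : Set (ℙ ℂ (ι → ℂ)), IsOpen U ∧ Y = X ∩ U

/-- Value at a vector of a tuple of polynomials. -/
def evalTuple {ι κ : Type*} (F : κ → MvPolynomial ι ℂ) (v : ι → ℂ) : κ → ℂ :=
  fun j => MvPolynomial.eval v (F j)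

/-- `φ` is regular on `X`: near every point of `X` it is given by a tuple of homogeneous polynomials
of one degree without common zero at that point. The neighbourhood may be taken to be the locus where
the tuple is not zero, because the tuple can be multiplied by a homogeneous polynomial. -/
def IsRegularOn {ι κ : Type*} (φ : ℙ ℂ (ι → ℂ) → ℙ ℂ (κ → ℂ)) (X : Set (ℙ ℂ (ι → ℂ))) : Prop :=
  ∀ x ∈ X, ∃ (d : ℕ) (F : κ → MvPolynomial ι ℂ),
    (∀ j, (F j).IsHomogeneous d) ∧ evalTuple F x.rep ≠ 0 ∧
    ∀ y ∈ X, evalTuple F y.rep ≠ 0 →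
      (φ y).submodule = Submodule.span ℂ {evalTuple F y.rep}

/-- Two varieties are birational: they have isomorphic non-empty Zariski-open subsets. -/
def Birational {ι κ : Type*} (X : Set (ℙ ℂ (ι → ℂ))) (Y : Set (ℙ ℂ (κ → ℂ))) : Prop :=
  IsVariety X ∧ IsVariety Y ∧
  ∃ (X' : Set (ℙ ℂ (ι → ℂ))) (Y' : Set (ℙ ℂ (κ → ℂ)))
    (φ : ℙ ℂ (ι → ℂ) → ℙ ℂ (κ → ℂ)) (ψ : ℙ ℂ (κ → ℂ) → ℙ ℂ (ι → ℂ)),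
    X'.Nonempty ∧ IsOpenSubsetOf X' X ∧ Y'.Nonempty ∧ IsOpenSubsetOf Y' Y ∧
    IsRegularOn φ X' ∧ IsRegularOn ψ Y' ∧
    Set.MapsTo φ X' Y' ∧ Set.MapsTo ψ Y' X' ∧ Set.InvOn ψ φ X' Y'

/-! ### Homogeneous spaces for `GL(m) × GL(n)` -/

/-- The entries of a pair of matrices as one vector. -/
def entries {m n : Type*} [Fintype m] [DecidableEq m] [Fintype n] [DecidableEq n]
    (g : GL m ℂ × GL n ℂ) : (m × m) ⊕ (n × n) → ℂ :=
  Sum.elim (fun q => g.1.1 q.1 q.2) (fun q => g.2.1 q.1 q.2)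

/-- Value at `(g, v)` of a tuple of polynomials in the coordinates of `v` whose coefficients are
polynomials in the entries of `g`. -/
def evalGroupTuple {ι κ m n : Type*} [Fintype m] [DecidableEq m] [Fintype n] [DecidableEq n]
    (F : κ → MvPolynomial ι (MvPolynomial ((m × m) ⊕ (n × n)) ℂ))
    (g : GL m ℂ × GL n ℂ) (v : ι → ℂ) : κ → ℂ :=
  fun j => MvPolynomial.eval₂ (MvPolynomial.eval (entries g)) v (F j)

/-- The map `(y, g) ↦ act y g` from `Y × (GL(m) × GL(n))` is regular: near every point it is given by
a tuple of polynomials in the entries of `g` and the coordinates of `y`, homogeneous of one degree in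
the latter (powers of determinants in denominators can be cleared). -/
def IsRegularAction {ι m n : Type*} [Fintype m] [DecidableEq m] [Fintype n] [DecidableEq n]
    (Y : Set (ℙ ℂ (ι → ℂ)))
    (act : ℙ ℂ (ι → ℂ) → GL m ℂ × GL n ℂ → ℙ ℂ (ι → ℂ)) : Prop :=
  ∀ y₀ ∈ Y, ∀ g₀ : GL m ℂ × GL n ℂ,
    ∃ (d : ℕ) (F : ι → MvPolynomial ι (MvPolynomial ((m × m) ⊕ (n × n)) ℂ)),
      (∀ j, (F j).IsHomogeneous d) ∧ evalGroupTuple F g₀ y₀.rep ≠ 0 ∧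
      ∀ y ∈ Y, ∀ g : GL m ℂ × GL n ℂ, evalGroupTuple F g y.rep ≠ 0 →
        (act y g).submodule = Submodule.span ℂ {evalGroupTuple F g y.rep}

/-- `Y`, with `act`, is a homogeneous space for the algebraic group `GL(m) × GL(n)`: a variety with a
transitive algebraic (right) action. -/
structure IsHomogeneousSpace {ι m n : Type*} [Fintype m] [DecidableEq m] [Fintype n] [DecidableEq n]
    (Y : Set (ℙ ℂ (ι → ℂ)))
    (act : ℙ ℂ (ι → ℂ) → GL m ℂ × GL n ℂ → ℙ ℂ (ι → ℂ)) : Prop where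
  variety : IsVariety Y
  mapsTo : ∀ y ∈ Y, ∀ g, act y g ∈ Y
  act_one : ∀ y ∈ Y, act y 1 = y
  act_mul : ∀ y ∈ Y, ∀ g g', act y (g * g') = act (act y g) g'
  regular : IsRegularAction Y act
  transitive : ∀ y ∈ Y, ∀ z ∈ Y, ∃ g, act y g = z

/-! ### Bifocal Grassmann tensors -/

/-- The pairs `(M₁, M₂)` of transposed projection matrices from `ℙ^k` to `ℙ^h₁` and `ℙ^h₂`: of maximal
rank and with disjoint centres `ℙ(ker M₁ᵀ)`, `ℙ(ker M₂ᵀ)`. -/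
def projectionPairs (k h₁ h₂ : ℕ) :
    Set (Matrix (Fin (k + 1)) (Fin (h₁ + 1)) ℂ × Matrix (Fin (k + 1)) (Fin (h₂ + 1)) ℂ) :=
  {M | M.1.rank = h₁ + 1 ∧ M.2.rank = h₂ + 1 ∧
    LinearMap.ker M.1.transpose.mulVecLin ⊓ LinearMap.ker M.2.transpose.mulVecLin = ⊥}

/-- The index set of the Plücker coordinates on `G(r, ℂ^c)`. -/
abbrev PluckerIndex (r : ℕ) (c : Type*) : Type _ := {S : Finset c // S.card = r}

/-- The Plücker coordinates of the row space of a matrix with `r` rows: its maximal minors. -/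
def pluckerVector {r : ℕ} {c : Type*} [LinearOrder c] (M : Matrix (Fin r) c ℂ) :
    PluckerIndex r c → ℂ :=
  fun S => (M.submatrix id (S.1.orderEmbOfFin S.2)).det

/-- The `h₁ + 1` and `h₂ + 1` columns of `[M₁|M₂]`, in this order. -/
abbrev Cols (h₁ h₂ : ℕ) : Type := Fin (h₁ + 1) ⊕ₗ Fin (h₂ + 1)

/-- The matrix `[M₁|M₂]`. -/
def joint {k h₁ h₂ : ℕ}
    (M : Matrix (Fin (k + 1)) (Fin (h₁ + 1)) ℂ × Matrix (Fin (k + 1)) (Fin (h₂ + 1)) ℂ) :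
    Matrix (Fin (k + 1)) (Cols h₁ h₂) ℂ :=
  (Matrix.fromCols M.1 M.2).submatrix id ofLex

/-- The open subset of the Plücker-embedded Grassmannian `G(k + 1, h₁ + h₂ + 2)` that consists of the
row spaces of the matrices `[M₁|M₂]`, for all pairs of projections with disjoint centres. -/
def openGrassmannian (k h₁ h₂ : ℕ) : Set (ℙ ℂ (PluckerIndex (k + 1) (Cols h₁ h₂) → ℂ)) :=
  {p | ∃ M ∈ projectionPairs k h₁ h₂, p.submodule = Submodule.span ℂ {pluckerVector (joint M)}}

/-- The coordinates on `⋀^α₁ ℂ^(h₁+1) ⊗ ⋀^α₂ ℂ^(h₂+1)`: the sets of `α₁` columns of the first block and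
`α₂` columns of the second block. -/
abbrev TensorIndex (k h₁ h₂ α₁ α₂ : ℕ) : Type :=
  {S : PluckerIndex (k + 1) (Cols h₁ h₂) //
    (S.1.filter fun c => (ofLex c).isLeft = true).card = α₁ ∧
    (S.1.filter fun c => (ofLex c).isRight = true).card = α₂}

/-- The coordinate projection of `⋀^(k+1) (ℂ^(h₁+1) ⊕ ℂ^(h₂+1))` onto its direct summand
`⋀^α₁ ℂ^(h₁+1) ⊗ ⋀^α₂ ℂ^(h₂+1)`. -/
def tensorProjection (k h₁ h₂ α₁ α₂ : ℕ) :
    (PluckerIndex (k + 1) (Cols h₁ h₂) → ℂ) →ₗ[ℂ] (TensorIndex k h₁ h₂ α₁ α₂ → ℂ) :=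
  LinearMap.funLeft ℂ ℂ Subtype.val

/-- The bifocal Grassmann tensor of a pair of projections. -/
def bifocalTensor {k h₁ h₂ : ℕ} (α₁ α₂ : ℕ)
    (M : Matrix (Fin (k + 1)) (Fin (h₁ + 1)) ℂ × Matrix (Fin (k + 1)) (Fin (h₂ + 1)) ℂ) :
    TensorIndex k h₁ h₂ α₁ α₂ → ℂ :=
  tensorProjection k h₁ h₂ α₁ α₂ (pluckerVector (joint M))

/-- The variety of bifocal Grassmann tensors with profile `(α₁, α₂)`: the Zariski closure of the
linear projection of `openGrassmannian`. -/
def bifocalVariety (k h₁ h₂ α₁ α₂ : ℕ) : Set (ℙ ℂ (TensorIndex k h₁ h₂ α₁ α₂ → ℂ)) :=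
  closure {q | ∃ p ∈ openGrassmannian k h₁ h₂,
    q.submodule = p.submodule.map (tensorProjection k h₁ h₂ α₁ α₂)}

/-- The right action of `GL(h₁+1) × GL(h₂+1)` on pairs of matrices, `(M₁H₁, M₂H₂)`. -/
def moveCols {k h₁ h₂ : ℕ}
    (M : Matrix (Fin (k + 1)) (Fin (h₁ + 1)) ℂ × Matrix (Fin (k + 1)) (Fin (h₂ + 1)) ℂ)
    (H : GL (Fin (h₁ + 1)) ℂ × GL (Fin (h₂ + 1)) ℂ) :
    Matrix (Fin (k + 1)) (Fin (h₁ + 1)) ℂ × Matrix (Fin (k + 1)) (Fin (h₂ + 1)) ℂ :=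
  (M.1 * H.1.1, M.2 * H.2.1)

end

end Bifocal

/-! The image of the open Grassmannian is a single orbit of $GL(h_1+1)\times GL(h_2+1)$ on a
projective space, and an orbit of an algebraic group is irreducible and open in its closure.

One orbit: a pair in $\mathfrak W_0$ amounts to two injections $U_1,U_2\to W=\mathbb C^{k+1}$ that
are jointly surjective. Up to an automorphism of $W$ it is determined by the kernel of $U_1\oplus
U_2\to W$. This kernel has fixed dimension and meets both summands trivially, so it is the graph of
an isomorphism between subspaces of $U_1$ and $U_2$; all such graphs are conjugate under
$GL(U_1)\times GL(U_2)$. An automorphism $B$ of $W$ multiplies every maximal minor by $\det B$ and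
fixes the point (`exists_mul_eq_moveCols`, `exists_span_bifocalTensor_eq`). By Cauchy–Binet the
group acts on tensors linearly, through minors of block diagonal matrices
(`bifocalTensor_moveCols`), and one explicit tensor is non-zero (`exists_bifocalTensor_ne_zero`).

Open in its closure: since $\alpha_1\ge1$ and $\mathbb C$ has roots, the representation contains all
homotheties, so the punctured cone over the orbit is the orbit of a vector. Chevalley's theorem
(`MvPolynomial.exists_basicOpen_subset_image`) yields one non-empty open piece of the closure inside
this cone, and its translates cover the orbit (`isOpenSubsetOf_closure_projectiveOrbit`). -/

/-! ### Homogeneous polynomials on lines through the origin -/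

open MvPolynomial in
/-- A homogeneous polynomial of degree `d` scales by `c ^ d`. -/
theorem MvPolynomial.IsHomogeneous.eval_const_smul {σ R : Type*} [CommSemiring R]
    {f : MvPolynomial σ R} {d : ℕ} (hf : f.IsHomogeneous d) (c : R) (v : σ → R) :
    eval (c • v) f = c ^ d * eval v f := by
  rw [eval_eq, eval_eq, Finset.mul_sum]
  refine Finset.sum_congr rfl fun e he => ?_
  have hd : ∑ i ∈ e.support, e i = d := (hf.degree_eq_sum_deg_support he).symm
  simp only [Pi.smul_apply, smul_eq_mul, mul_pow, Finset.prod_mul_distrib]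
  rw [Finset.prod_pow_eq_pow_sum, hd]
  ring

open MvPolynomial in
/-- The values of a polynomial on a line through the origin form a polynomial whose coefficients are
the values of the homogeneous components. -/
theorem MvPolynomial.exists_polynomial_eval_smul {σ R : Type*} [CommSemiring R]
    (p : MvPolynomial σ R) (v : σ → R) :
    ∃ P : Polynomial R, (∀ c, P.eval c = eval (c • v) p) ∧
      ∀ d, P.coeff d = eval v (homogeneousComponent d p) := by
  classical
  refine ⟨∑ d ∈ Finset.range (p.totalDegree + 1),
    Polynomial.monomial d (eval v (homogeneousComponent d p)), fun c => ?_, fun d => ?_⟩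
  · conv_rhs => rw [← sum_homogeneousComponent p]
    rw [Polynomial.eval_finsetSum, map_sum]
    refine Finset.sum_congr rfl fun d _ => ?_
    rw [(homogeneousComponent_isHomogeneous d p).eval_const_smul, Polynomial.eval_monomial, mul_comm]
  · rw [Polynomial.finsetSum_coeff]
    simp only [Polynomial.coeff_monomial]
    rw [Finset.sum_ite_eq']
    split_ifs with h
    · rfl
    · rw [homogeneousComponent_eq_zero, map_zero]
      simpa [Nat.lt_succ_iff] using h

/-! ### Chevalley's theorem for polynomial maps -/

open Topology in
/-- A constructible subset of a prime spectrum contains or avoids a neighbourhood of a given point in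
its closure. -/
theorem PrimeSpectrum.exists_basicOpen_of_isConstructible {A : Type*} [CommRing A]
    (x : PrimeSpectrum A) {s : Set (PrimeSpectrum A)} (hs : IsConstructible s) (hx : x ∈ s) :
    ∃ a ∉ x.asIdeal, ∀ y : PrimeSpectrum A, x ≤ y → a ∉ y.asIdeal → y ∈ s := by
  -- Unlike the conclusion alone, this dichotomy is stable under complements, so it can be proved by
  -- induction on constructible sets.
  suffices H : (∃ a ∉ x.asIdeal, ∀ y : PrimeSpectrum A, x ≤ y → a ∉ y.asIdeal → y ∈ s) ∨
      (∃ a ∉ x.asIdeal, ∀ y : PrimeSpectrum A, x ≤ y → a ∉ y.asIdeal → y ∉ s) by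
    rcases H with H | ⟨a, ha, H⟩
    · exact H
    · exact absurd hx (H x le_rfl ha)
  clear hx
  induction hs using IsConstructible.empty_union_induction with
  | open_retrocompact U hU _ =>
    by_cases hxU : x ∈ U
    · obtain ⟨_, ⟨a, rfl⟩, ha, haU⟩ :=
        PrimeSpectrum.isTopologicalBasis_basic_opens.exists_subset_of_mem_open hxU hU
      exact Or.inl ⟨a, ha, fun y _ hy => haU hy⟩
    -- Open sets are stable under generalization: outside `U`, the point `x` has no specialization
    -- in `U`, and `a = 1` will do.
    · refine Or.inr ⟨1, fun h => x.2.ne_top ((Ideal.eq_top_iff_one _).2 h), fun y hxy _ hy => hxU ?_⟩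
      exact ((PrimeSpectrum.le_iff_specializes x y).1 hxy).mem_open hU hy
  | union s _ t _ ihs iht =>
    rcases ihs with ⟨a, ha, h⟩ | ⟨a, ha, h⟩
    · exact Or.inl ⟨a, ha, fun y hxy hy => Or.inl (h y hxy hy)⟩
    · rcases iht with ⟨b, hb, h'⟩ | ⟨b, hb, h'⟩
      · exact Or.inl ⟨b, hb, fun y hxy hy => Or.inr (h' y hxy hy)⟩
      · refine Or.inr ⟨a * b, fun hab => (x.2.mem_or_mem hab).elim ha hb, fun y hxy hy => ?_⟩
        rintro (hs | ht)
        · exact h y hxy (fun h1 => hy (Ideal.mul_mem_right _ _ h1)) hs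
        · exact h' y hxy (fun h1 => hy (Ideal.mul_mem_left _ _ h1)) ht
  | compl s _ ih =>
    rcases ih with ⟨a, ha, h⟩ | ⟨a, ha, h⟩
    · exact Or.inr ⟨a, ha, fun y hxy hy => not_not.2 (h y hxy hy)⟩
    · exact Or.inl ⟨a, ha, h⟩

open MvPolynomial in
/-- Chevalley's theorem for a polynomial map between affine spaces: the image of a non-empty basic
open set contains a non-empty basic open subset of its closure. -/
theorem MvPolynomial.exists_basicOpen_subset_image {K ι κ : Type*} [Field K] [IsAlgClosed K]
    [Finite ι] [Finite κ] (f : ι → MvPolynomial κ K) {D : MvPolynomial κ K} (hD : D ≠ 0) :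
    ∃ a : MvPolynomial ι K, aeval f a ≠ 0 ∧ ∀ v : ι → K,
      (∀ p : MvPolynomial ι K, aeval f p = 0 → eval v p = 0) → eval v a ≠ 0 →
      ∃ x : κ → K, eval x D ≠ 0 ∧ ∀ i, eval x (f i) = v i := by
  let φ : MvPolynomial ι K →+* MvPolynomial κ K := (aeval f).toRingHom
  have hφ : φ.FinitePresentation := by
    rw [← RingHom.FinitePresentation.of_finiteType]
    refine RingHom.FiniteType.of_comp_finiteType (f := (C : K →+* MvPolynomial ι K)) ?_
    have : φ.comp C = C := by
      ext; simp [φ]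
    rw [this]
    exact RingHom.finiteType_algebraMap.2 (inferInstanceAs (Algebra.FiniteType K (MvPolynomial κ K)))
  have hc : Topology.IsConstructible
      (PrimeSpectrum.comap φ '' (PrimeSpectrum.basicOpen D : Set (PrimeSpectrum (MvPolynomial κ K)))) :=
    PrimeSpectrum.isConstructible_comap_image hφ
      (PrimeSpectrum.isRetrocompact_basicOpen.isConstructible (PrimeSpectrum.basicOpen D).2)
  -- The generic point of the source; its image is the kernel of `φ`, the generic point of the
  -- closure of the image.
  let z : PrimeSpectrum (MvPolynomial κ K) := ⟨⊥, Ideal.isPrime_bot⟩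
  obtain ⟨a, ha, H⟩ := PrimeSpectrum.exists_basicOpen_of_isConstructible (PrimeSpectrum.comap φ z) hc
    ⟨z, by simpa [z] using hD, rfl⟩
  refine ⟨a, fun h0 => ha (by simpa [z, φ] using h0), fun v hv hav => ?_⟩
  obtain ⟨q, hq, hqv⟩ := H ⟨vanishingIdeal K {v}, inferInstance⟩
    (fun p hp => by
      rw [mem_vanishingIdeal_singleton_iff]
      exact hv p (by simpa [z, φ] using hp))
    (fun h => hav (by
      rw [mem_vanishingIdeal_singleton_iff] at h
      exact h))
  -- The prime `q` over the point `v` need not be maximal; the Nullstellensatz supplies a closed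
  -- point of its zero locus at which `D` is not zero, and this point still maps to `v`.
  have hDq : D ∉ vanishingIdeal K (zeroLocus K q.asIdeal) := by
    rw [IsPrime.vanishingIdeal_zeroLocus]
    exact hq
  rw [mem_vanishingIdeal_iff] at hDq
  push Not at hDq
  obtain ⟨x, hx, hxD⟩ := hDq
  refine ⟨x, hxD, fun i => ?_⟩
  have hmem : X i - C (v i) ∈ (PrimeSpectrum.comap φ q).asIdeal := by
    rw [hqv]
    change _ ∈ vanishingIdeal K {v}
    rw [mem_vanishingIdeal_singleton_iff]
    simp
  have := mem_zeroLocus_iff.1 hx _ hmem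
  simpa [φ, sub_eq_zero] using this

/-! ### Representatives of projective points -/

theorem Projectivization.exists_rep_eq_smul {K V : Type*} [Field K] [AddCommGroup V] [Module K V]
    {y : ℙ K V} {w : V} (h : y.submodule = Submodule.span K {w}) :
    ∃ c : K, c ≠ 0 ∧ y.rep = c • w := by
  have hm : y.rep ∈ Submodule.span K {w} := by
    rw [← h, y.submodule_eq]
    exact Submodule.mem_span_singleton_self _
  obtain ⟨c, hc⟩ := Submodule.mem_span_singleton.1 hm
  refine ⟨c, ?_, hc.symm⟩
  rintro rfl
  exact y.rep_nonzero (by rw [← hc, zero_smul])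

theorem Projectivization.submodule_eq_span_of_rep {K V : Type*} [Field K] [AddCommGroup V]
    [Module K V] {y : ℙ K V} {w : V} {c : K} (hc : c ≠ 0) (h : y.rep = c • w) :
    y.submodule = Submodule.span K {w} := by
  rw [y.submodule_eq, h]
  exact Submodule.span_singleton_smul_eq hc.isUnit w

/-! ### The Zariski topology -/

namespace Bifocal

/-- The complements of hypersurfaces are a basis of the Zariski topology. -/
theorem exists_eval_ne_zero_of_isOpen {ι : Type*} {U : Set (ℙ ℂ (ι → ℂ))} (hU : IsOpen U)
    {p : ℙ ℂ (ι → ℂ)} (hp : p ∈ U) :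
    ∃ (d : ℕ) (f : MvPolynomial ι ℂ), f.IsHomogeneous d ∧ MvPolynomial.eval p.rep f ≠ 0 ∧
      ∀ q : ℙ ℂ (ι → ℂ), MvPolynomial.eval q.rep f ≠ 0 → q ∈ U := by
  induction hU with
  | basic s hs =>
    obtain ⟨d, f, hf, rfl⟩ := hs
    exact ⟨d, f, hf, hp, fun q hq => hq⟩
  | univ => exact ⟨0, 1, MvPolynomial.isHomogeneous_one _ _, by simp, fun _ _ => trivial⟩
  | inter s t _ _ ihs iht =>
    obtain ⟨d, f, hf, hfp, hfs⟩ := ihs hp.1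
    obtain ⟨e, g, hg, hgp, hgt⟩ := iht hp.2
    refine ⟨d + e, f * g, hf.mul hg, by simp [hfp, hgp], fun q hq => ?_⟩
    rw [map_mul] at hq
    exact ⟨hfs q (left_ne_zero_of_mul hq), hgt q (right_ne_zero_of_mul hq)⟩
  | sUnion S _ ih =>
    obtain ⟨s, hs, hps⟩ := hp
    obtain ⟨d, f, hf, hfp, hfs⟩ := ih s hs hps
    exact ⟨d, f, hf, hfp, fun q hq => ⟨s, hs, hfs q hq⟩⟩

theorem isOpen_eval_ne_zero {ι : Type*} {d : ℕ} {f : MvPolynomial ι ℂ} (hf : f.IsHomogeneous d) :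
    IsOpen {p : ℙ ℂ (ι → ℂ) | MvPolynomial.eval p.rep f ≠ 0} :=
  TopologicalSpace.isOpen_generateFrom_of_mem ⟨d, f, hf, rfl⟩

/-- A homogeneous polynomial which vanishes on a set vanishes on its Zariski closure. -/
theorem eval_rep_eq_zero_of_mem_closure {ι : Type*} {Y : Set (ℙ ℂ (ι → ℂ))} {q : ℙ ℂ (ι → ℂ)}
    (hq : q ∈ closure Y) {d : ℕ} {f : MvPolynomial ι ℂ} (hf : f.IsHomogeneous d)
    (hY : ∀ y ∈ Y, MvPolynomial.eval y.rep f = 0) : MvPolynomial.eval q.rep f = 0 := by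
  by_contra h
  obtain ⟨y, hy, hyY⟩ := mem_closure_iff.1 hq _ (isOpen_eval_ne_zero hf) h
  exact hy (hY y hyY)

/-! ### Orbits of representations that contain the homotheties -/

section Orbit

variable {ι m n : Type*} [Fintype ι] [DecidableEq ι] [Fintype m] [DecidableEq m] [Fintype n]
  [DecidableEq n]

/-- The value at a group element of a matrix whose entries are polynomials on the group. -/
noncomputable def specialize (R : Matrix ι ι (MvPolynomial ((m × m) ⊕ (n × n)) ℂ))
    (g : GL m ℂ × GL n ℂ) : Matrix ι ι ℂ :=
  R.map (MvPolynomial.eval (entries g))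

/-- A polynomial right representation of `GL(m) × GL(n)` whose image contains all the homotheties. -/
structure IsConicalRep (R : Matrix ι ι (MvPolynomial ((m × m) ⊕ (n × n)) ℂ)) : Prop where
  one : specialize R 1 = 1
  mul : ∀ g g', specialize R (g * g') = specialize R g' * specialize R g
  homothety : ∀ c : ℂ, c ≠ 0 → ∃ g, specialize R g = c • 1

variable {R : Matrix ι ι (MvPolynomial ((m × m) ⊕ (n × n)) ℂ)}

theorem IsConicalRep.inv_mul (hR : IsConicalRep R) (g : GL m ℂ × GL n ℂ) :
    specialize R g⁻¹ * specialize R g = 1 := by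
  rw [← hR.mul, mul_inv_cancel, hR.one]

theorem IsConicalRep.mulVec_injective (hR : IsConicalRep R) (g : GL m ℂ × GL n ℂ) :
    Function.Injective (specialize R g).mulVecLin := by
  intro v w h
  have := congrArg (fun u => (specialize R g⁻¹).mulVec u) h
  simpa [Matrix.mulVec_mulVec, hR.inv_mul] using this

/-- The action on the projective space which a representation induces. -/
noncomputable def projectiveAction (hR : IsConicalRep R) (y : ℙ ℂ (ι → ℂ)) (g : GL m ℂ × GL n ℂ) :
    ℙ ℂ (ι → ℂ) :=
  Projectivization.map (specialize R g).mulVecLin (hR.mulVec_injective g) y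

/-- This frees computations from the arbitrary choice of `rep`: identities in the projective space
are checked on any spanning vector. -/
theorem projectiveAction_submodule (hR : IsConicalRep R) {y : ℙ ℂ (ι → ℂ)} {v : ι → ℂ}
    (h : y.submodule = Submodule.span ℂ {v}) (g : GL m ℂ × GL n ℂ) :
    (projectiveAction hR y g).submodule = Submodule.span ℂ {(specialize R g).mulVec v} := by
  have hv : v ≠ 0 := by
    rintro rfl
    obtain ⟨c, hc, h'⟩ := Projectivization.exists_rep_eq_smul h
    exact y.rep_nonzero (by simpa using h')
  have hy : y = Projectivization.mk ℂ v hv :=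
    Projectivization.submodule_injective (by rw [h, Projectivization.submodule_mk])
  subst hy
  rw [projectiveAction, Projectivization.map_mk, Projectivization.submodule_mk]
  rfl

theorem projectiveAction_one (hR : IsConicalRep R) (y : ℙ ℂ (ι → ℂ)) :
    projectiveAction hR y 1 = y := by
  apply Projectivization.submodule_injective
  rw [projectiveAction_submodule hR y.submodule_eq, hR.one, Matrix.one_mulVec, y.submodule_eq]

theorem projectiveAction_mul (hR : IsConicalRep R) (y : ℙ ℂ (ι → ℂ)) (g g' : GL m ℂ × GL n ℂ) :
    projectiveAction hR y (g * g') = projectiveAction hR (projectiveAction hR y g) g' := by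
  apply Projectivization.submodule_injective
  rw [projectiveAction_submodule hR y.submodule_eq,
    projectiveAction_submodule hR (projectiveAction_submodule hR y.submodule_eq g), hR.mul,
    Matrix.mulVec_mulVec]

/-- The orbit of the line through `v₀`. -/
def projectiveOrbit (R : Matrix ι ι (MvPolynomial ((m × m) ⊕ (n × n)) ℂ)) (v₀ : ι → ℂ) :
    Set (ℙ ℂ (ι → ℂ)) :=
  {y | ∃ g, y.submodule = Submodule.span ℂ {(specialize R g).mulVec v₀}}

/-- The coordinates of the orbit map of `v₀`. -/
noncomputable def orbitPolynomial (R : Matrix ι ι (MvPolynomial ((m × m) ⊕ (n × n)) ℂ)) (v₀ : ι → ℂ)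
    (i : ι) : MvPolynomial ((m × m) ⊕ (n × n)) ℂ :=
  ∑ j, R i j * MvPolynomial.C (v₀ j)

omit [DecidableEq ι] in
theorem eval_orbitPolynomial (v₀ : ι → ℂ) (g : GL m ℂ × GL n ℂ) :
    (fun i => MvPolynomial.eval (entries g) (orbitPolynomial R v₀ i)) =
      (specialize R g).mulVec v₀ := by
  ext i
  simp [orbitPolynomial, specialize, Matrix.mulVec, dotProduct]

omit [DecidableEq ι] in
theorem eval_aeval_orbitPolynomial (v₀ : ι → ℂ) (g : GL m ℂ × GL n ℂ) (p : MvPolynomial ι ℂ) :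
    MvPolynomial.eval (entries g) (MvPolynomial.aeval (orbitPolynomial R v₀) p) =
      MvPolynomial.eval ((specialize R g).mulVec v₀) p := by
  rw [← eval_orbitPolynomial, ← MvPolynomial.bind₁, MvPolynomial.eval, MvPolynomial.eval₂Hom_bind₁]
  rfl

variable (m n) in
/-- The product of the two determinants. -/
noncomputable def detPolynomial : MvPolynomial ((m × m) ⊕ (n × n)) ℂ :=
  MvPolynomial.rename Sum.inl (Matrix.mvPolynomialX m m ℂ).det *
    MvPolynomial.rename Sum.inr (Matrix.mvPolynomialX n n ℂ).det

theorem eval_detPolynomial (x : (m × m) ⊕ (n × n) → ℂ) :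
    MvPolynomial.eval x (detPolynomial m n) =
      (Matrix.of fun i j => x (Sum.inl (i, j))).det *
        (Matrix.of fun i j => x (Sum.inr (i, j))).det := by
  rw [detPolynomial, map_mul, MvPolynomial.eval_rename, MvPolynomial.eval_rename, RingHom.map_det,
    RingHom.map_det]
  congr 2 <;> ext i j <;> simp

/-- It presents the group as a principal open subset of an affine space, the form of source that
Chevalley's theorem requires. -/
theorem eval_detPolynomial_ne_zero_iff (x : (m × m) ⊕ (n × n) → ℂ) :
    MvPolynomial.eval x (detPolynomial m n) ≠ 0 ↔ ∃ g : GL m ℂ × GL n ℂ, entries g = x := by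
  rw [eval_detPolynomial]
  constructor
  · intro h
    refine ⟨(Matrix.GeneralLinearGroup.mkOfDetNeZero _ (left_ne_zero_of_mul h),
      Matrix.GeneralLinearGroup.mkOfDetNeZero _ (right_ne_zero_of_mul h)), ?_⟩
    ext (q | q) <;> rfl
  · rintro ⟨g, rfl⟩
    exact mul_ne_zero g.1.det.ne_zero g.2.det.ne_zero

theorem detPolynomial_ne_zero : detPolynomial m n ≠ 0 := by
  intro h
  have := (eval_detPolynomial_ne_zero_iff (entries (1 : GL m ℂ × GL n ℂ))).2 ⟨1, rfl⟩
  simp [h] at this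

/-- A non-zero polynomial on the group does not vanish at some element of it. -/
theorem exists_eval_entries_ne_zero {p : MvPolynomial ((m × m) ⊕ (n × n)) ℂ} (hp : p ≠ 0) :
    ∃ g : GL m ℂ × GL n ℂ, MvPolynomial.eval (entries g) p ≠ 0 := by
  by_contra! H
  have h0 : detPolynomial m n * p = 0 := by
    refine MvPolynomial.funext fun x => ?_
    rw [map_mul, map_zero]
    by_cases hx : MvPolynomial.eval x (detPolynomial m n) = 0
    · rw [hx, zero_mul]
    · obtain ⟨g, rfl⟩ := (eval_detPolynomial_ne_zero_iff x).1 hx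
      rw [H, mul_zero]
  exact (mul_ne_zero detPolynomial_ne_zero hp) h0

/-- Basic open sets that meet the orbit pull back to non-vanishing loci of non-zero polynomials on
the group. The product of two such polynomials is non-zero, hence non-zero at some group element. -/
theorem isIrreducible_projectiveOrbit (hR : IsConicalRep R) {v₀ : ι → ℂ} (hv₀ : v₀ ≠ 0) :
    IsIrreducible (projectiveOrbit R v₀) := by
  refine ⟨⟨Projectivization.mk ℂ v₀ hv₀, 1, by
    rw [hR.one, Matrix.one_mulVec, Projectivization.submodule_mk]⟩, ?_⟩
  rintro U W hU hW ⟨y, ⟨g, hg⟩, hyU⟩ ⟨z, ⟨h, hh⟩, hzW⟩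
  obtain ⟨d, f, hf, hfy, hfU⟩ := exists_eval_ne_zero_of_isOpen hU hyU
  obtain ⟨e, f', hf', hfz, hfW⟩ := exists_eval_ne_zero_of_isOpen hW hzW
  have key : ∀ {d : ℕ} {f : MvPolynomial ι ℂ} (_ : f.IsHomogeneous d) {y : ℙ ℂ (ι → ℂ)}
      {g : GL m ℂ × GL n ℂ} (_ : y.submodule = Submodule.span ℂ {(specialize R g).mulVec v₀}),
      MvPolynomial.eval y.rep f ≠ 0 ↔
        MvPolynomial.eval (entries g) (MvPolynomial.aeval (orbitPolynomial R v₀) f) ≠ 0 := by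
    intro d f hf y g hg
    obtain ⟨c, hc, hy⟩ := Projectivization.exists_rep_eq_smul hg
    rw [hy, hf.eval_const_smul, eval_aeval_orbitPolynomial]
    simp [hc]
  have h1 := (key hf hg).1 hfy
  have h2 := (key hf' hh).1 hfz
  obtain ⟨k, hk⟩ := exists_eval_entries_ne_zero (m := m) (n := n)
    (mul_ne_zero (fun h0 => h1 (by rw [h0, map_zero])) (fun h0 => h2 (by rw [h0, map_zero])) :
      MvPolynomial.aeval (orbitPolynomial R v₀) f * MvPolynomial.aeval (orbitPolynomial R v₀) f' ≠ 0)
  rw [map_mul] at hk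
  have hw : (specialize R k).mulVec v₀ ≠ 0 := fun h0 =>
    hv₀ (hR.mulVec_injective k (by simpa using h0))
  have hx : (Projectivization.mk ℂ _ hw).submodule =
      Submodule.span ℂ {(specialize R k).mulVec v₀} := Projectivization.submodule_mk _ _
  exact ⟨Projectivization.mk ℂ _ hw, ⟨k, hx⟩, hfU _ ((key hf hx).2 (left_ne_zero_of_mul hk)),
    hfW _ ((key hf' hx).2 (right_ne_zero_of_mul hk))⟩

/-- All polynomials which vanish on the cone over an orbit vanish on the cone over its closure. -/
theorem eval_eq_zero_of_mem_closure_projectiveOrbit (hR : IsConicalRep R) {v₀ : ι → ℂ}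
    {q : ℙ ℂ (ι → ℂ)} (hq : q ∈ closure (projectiveOrbit R v₀)) {p : MvPolynomial ι ℂ}
    (hp : ∀ g, MvPolynomial.eval ((specialize R g).mulVec v₀) p = 0) :
    MvPolynomial.eval q.rep p = 0 := by
  rw [← MvPolynomial.sum_homogeneousComponent p, map_sum]
  refine Finset.sum_eq_zero fun d _ => ?_
  refine eval_rep_eq_zero_of_mem_closure hq (MvPolynomial.homogeneousComponent_isHomogeneous d p) ?_
  rintro y ⟨g, hg⟩
  obtain ⟨c, -, hy⟩ := Projectivization.exists_rep_eq_smul hg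
  rw [hy, (MvPolynomial.homogeneousComponent_isHomogeneous d p).eval_const_smul]
  -- By the homotheties `p` vanishes on the whole punctured line, so `P` has infinitely many roots;
  -- its coefficients are the values of the homogeneous components of `p`.
  obtain ⟨P, hP, hcoeff⟩ := p.exists_polynomial_eval_smul ((specialize R g).mulVec v₀)
  have : P = 0 := by
    refine Polynomial.eq_zero_of_infinite_isRoot P
      ((Set.finite_singleton (0 : ℂ)).infinite_compl.mono fun a ha => ?_)
    obtain ⟨h, hh⟩ := hR.homothety a ha
    have := hp (g * h)
    rw [hR.mul, hh] at this
    rw [Set.mem_ofPred_eq, Polynomial.IsRoot, hP, ← this]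
    simp [Matrix.smul_mulVec]
  rw [← hcoeff, this, Polynomial.coeff_zero, mul_zero]

/-- An orbit is open in its closure. -/
theorem isOpenSubsetOf_closure_projectiveOrbit (hR : IsConicalRep R) (v₀ : ι → ℂ) :
    IsOpenSubsetOf (projectiveOrbit R v₀) (closure (projectiveOrbit R v₀)) := by
  obtain ⟨a, ha, hsub⟩ := MvPolynomial.exists_basicOpen_subset_image (orbitPolynomial R v₀)
    (detPolynomial_ne_zero (m := m) (n := n))
  obtain ⟨g₁, hg₁⟩ := exists_eval_entries_ne_zero ha
  rw [eval_aeval_orbitPolynomial] at hg₁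
  -- The polynomial `a` need not be homogeneous; a component that is non-zero at some point of the
  -- cone defines an open set of the projective space.
  obtain ⟨d, hd⟩ : ∃ d, MvPolynomial.eval ((specialize R g₁).mulVec v₀)
      (MvPolynomial.homogeneousComponent d a) ≠ 0 := by
    by_contra! H
    rw [← MvPolynomial.sum_homogeneousComponent a, map_sum] at hg₁
    exact hg₁ (Finset.sum_eq_zero fun d _ => H d)
  let b := MvPolynomial.homogeneousComponent d a
  have hb : b.IsHomogeneous d := MvPolynomial.homogeneousComponent_isHomogeneous d a
  -- Substituting the linear forms `L A` into a polynomial composes it with `A`; this is how open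
  -- sets and equations are translated.
  let L : Matrix ι ι ℂ → ι → MvPolynomial ι ℂ := fun A i =>
    ∑ j, MvPolynomial.C (A i j) * MvPolynomial.X j
  have hL : ∀ A i, (L A i).IsHomogeneous 1 := fun A i =>
    MvPolynomial.IsHomogeneous.sum _ _ _ fun j _ => MvPolynomial.isHomogeneous_C_mul_X _ _
  have hLeval : ∀ A p v, MvPolynomial.eval v (MvPolynomial.aeval (L A) p) =
      MvPolynomial.eval (A.mulVec v) p := by
    intro A p v
    have : A.mulVec v = fun i => MvPolynomial.eval v (L A i) := by
      ext i
      simp [L, Matrix.mulVec, dotProduct]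
    rw [this, ← MvPolynomial.bind₁, MvPolynomial.eval, MvPolynomial.eval₂Hom_bind₁]
    rfl
  refine ⟨⋃ h : GL m ℂ × GL n ℂ, {q | MvPolynomial.eval q.rep
    (MvPolynomial.aeval (L (specialize R h)) b) ≠ 0},
    isOpen_iUnion fun h => isOpen_eval_ne_zero (hb.aeval _ (hL _)), ?_⟩
  refine Set.Subset.antisymm (fun y hy => ⟨subset_closure hy, ?_⟩) ?_
  · obtain ⟨g, hg⟩ := hy
    obtain ⟨c, hc, hy⟩ := Projectivization.exists_rep_eq_smul hg
    refine Set.mem_iUnion.2 ⟨g⁻¹ * g₁, ?_⟩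
    rw [Set.mem_ofPred_eq, hLeval, hy, Matrix.mulVec_smul, hb.eval_const_smul, Matrix.mulVec_mulVec,
      ← hR.mul, mul_inv_cancel_left]
    exact mul_ne_zero (pow_ne_zero _ hc) hd
  · rintro q ⟨hq, hqU⟩
    obtain ⟨h, hh⟩ := Set.mem_iUnion.1 hqU
    rw [Set.mem_ofPred_eq, hLeval] at hh
    set w := (specialize R h).mulVec q.rep with hw
    -- One non-zero component at `w` makes `a` non-zero at some `c • w` with `c ≠ 0`, to which
    -- Chevalley's theorem can be applied.
    obtain ⟨P, hP, hcoeff⟩ := a.exists_polynomial_eval_smul w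
    have hP0 : P ≠ 0 := by
      rintro rfl
      exact hh (by rw [← hcoeff, Polynomial.coeff_zero])
    obtain ⟨c, hc0, hc⟩ : ∃ c : ℂ, c ≠ 0 ∧ P.eval c ≠ 0 := by
      by_contra! H
      exact hP0 (Polynomial.eq_zero_of_infinite_isRoot P
        ((Set.finite_singleton (0 : ℂ)).infinite_compl.mono fun x hx => H x hx))
    rw [hP] at hc
    -- The vector `c • w` is a translate of `q.rep`, and it satisfies all equations of the cone
    -- because translating an equation of an orbit gives another one.
    obtain ⟨x, hxD, hx⟩ := hsub (c • w) (fun p hp => by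
      obtain ⟨k, hk⟩ := hR.homothety c hc0
      have hcw : c • w = (specialize R (h * k)).mulVec q.rep := by
        rw [hR.mul, hk, hw]
        simp [Matrix.smul_mulVec]
      rw [hcw, ← hLeval]
      refine eval_eq_zero_of_mem_closure_projectiveOrbit hR hq fun g => ?_
      rw [hLeval, Matrix.mulVec_mulVec, ← hR.mul, ← eval_aeval_orbitPolynomial, hp, map_zero]) hc
    obtain ⟨g, rfl⟩ := (eval_detPolynomial_ne_zero_iff x).1 hxD
    have hx' : (specialize R g).mulVec v₀ = c • w := by
      rw [← eval_orbitPolynomial]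
      exact funext hx
    refine ⟨g * h⁻¹, Projectivization.submodule_eq_span_of_rep (inv_ne_zero hc0) ?_⟩
    rw [hR.mul, ← Matrix.mulVec_mulVec, hx', Matrix.mulVec_smul, inv_smul_smul₀ hc0, hw,
      Matrix.mulVec_mulVec, hR.inv_mul, Matrix.one_mulVec]

/-- An orbit of a representation which contains the homotheties is a homogeneous space. -/
theorem isHomogeneousSpace_projectiveOrbit (hR : IsConicalRep R) {v₀ : ι → ℂ} (hv₀ : v₀ ≠ 0) :
    IsHomogeneousSpace (projectiveOrbit R v₀) (projectiveAction hR) where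
  variety := by
    refine ⟨isIrreducible_projectiveOrbit hR hv₀, ?_⟩
    obtain ⟨U, hU, h⟩ := isOpenSubsetOf_closure_projectiveOrbit hR v₀
    rw [h]
    exact isClosed_closure.isLocallyClosed.inter hU.isLocallyClosed
  mapsTo := by
    rintro y ⟨h, hy⟩ g
    refine ⟨h * g, ?_⟩
    rw [projectiveAction_submodule hR hy, hR.mul, Matrix.mulVec_mulVec]
  act_one y _ := projectiveAction_one hR y
  act_mul y _ := projectiveAction_mul hR y
  regular := by
    intro y₀ _ g₀
    have heval : ∀ (g : GL m ℂ × GL n ℂ) (v : ι → ℂ),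
        evalGroupTuple (fun i => ∑ j, MvPolynomial.C (R i j) * MvPolynomial.X j) g v =
          (specialize R g).mulVec v := by
      intro g v
      ext i
      simp [evalGroupTuple, specialize, Matrix.mulVec, dotProduct, MvPolynomial.eval₂_sum]
    refine ⟨1, fun i => ∑ j, MvPolynomial.C (R i j) * MvPolynomial.X j, fun i =>
      MvPolynomial.IsHomogeneous.sum _ _ _ fun j _ => MvPolynomial.isHomogeneous_C_mul_X _ _, ?_,
      fun y _ g _ => ?_⟩
    · rw [heval]
      exact fun h0 => y₀.rep_nonzero (hR.mulVec_injective g₀ (by simpa using h0))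
    · rw [heval, projectiveAction_submodule hR y.submodule_eq]
  transitive := by
    rintro y ⟨g, hy⟩ z ⟨h, hz⟩
    refine ⟨g⁻¹ * h, Projectivization.submodule_injective ?_⟩
    rw [projectiveAction_submodule hR hy, hz, Matrix.mulVec_mulVec, ← hR.mul, mul_inv_cancel_left]

/-- A variety is birational to its non-empty open subsets. -/
theorem birational_of_isOpenSubsetOf {ι : Type*} {X Y : Set (ℙ ℂ (ι → ℂ))} (hX : IsVariety X)
    (hY : IsVariety Y) (h : IsOpenSubsetOf Y X) : Birational X Y := by
  have hid : IsRegularOn (id : ℙ ℂ (ι → ℂ) → ℙ ℂ (ι → ℂ)) Y := by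
    have heval : ∀ v : ι → ℂ, evalTuple MvPolynomial.X v = v := fun v => by
      ext i
      simp [evalTuple]
    intro x _
    refine ⟨1, MvPolynomial.X, fun j => MvPolynomial.isHomogeneous_X _ _, ?_, fun y _ _ => ?_⟩
    · rw [heval]
      exact x.rep_nonzero
    · rw [heval, id, y.submodule_eq]
  exact ⟨hX, hY, Y, Y, id, id, hY.1.1, h, hY.1.1, ⟨Set.univ, isOpen_univ, (Set.inter_univ Y).symm⟩,
    hid, hid, Set.mapsTo_id _, Set.mapsTo_id _, fun _ _ => rfl, fun _ _ => rfl⟩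

end Orbit

end Bifocal

namespace Bifocal

/-! ### Minors and the Cauchy–Binet formula -/

section Minors

variable {r : ℕ} {c A : Type*} [LinearOrder c] [CommRing A]

/-- The increasing enumeration of an index set. -/
def pluckerEmb (S : PluckerIndex r c) : Fin r → c := S.1.orderEmbOfFin S.2

theorem pluckerEmb_injective (S : PluckerIndex r c) : Function.Injective (pluckerEmb S) :=
  (S.1.orderEmbOfFin S.2).injective

theorem range_pluckerEmb (S : PluckerIndex r c) : Set.range (pluckerEmb S) = S.1 :=
  Finset.range_orderEmbOfFin S.1 S.2

theorem image_pluckerEmb (S : PluckerIndex r c) : Finset.univ.image (pluckerEmb S) = S.1 := by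
  rw [← Finset.coe_inj, Finset.coe_image, Finset.coe_univ, Set.image_univ, range_pluckerEmb]

theorem card_filter_pluckerIndex (S : PluckerIndex r c) (p : c → Prop) [DecidablePred p] :
    (S.1.filter p).card = (Finset.univ.filter fun j => p (pluckerEmb S j)).card := by
  rw [← image_pluckerEmb, Finset.filter_image,
    Finset.card_image_of_injective _ (pluckerEmb_injective S)]

/-- The minor of a square matrix with given rows and columns. -/
def minor (D : Matrix c c A) (S' S : PluckerIndex r c) : A :=
  (D.submatrix (pluckerEmb S') (pluckerEmb S)).det

-- The columns of `M * D` are combinations of the columns of `M`, and the determinant is multilinear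
-- in columns.
omit [LinearOrder c] in
theorem det_mul_eq_sum_pi [Fintype c] (M : Matrix (Fin r) c A) (D : Matrix c (Fin r) A) :
    (M * D).det = ∑ f : Fin r → c, (∏ j, D (f j) j) * (M.submatrix id f).det := by
  have h : (M * D).transpose = fun j => ∑ i, D i j • M.transpose i := by
    ext j i
    simp [Matrix.mul_apply, mul_comm]
  rw [← Matrix.det_transpose, h]
  refine ((Matrix.detRowAlternating (R := A) (n := Fin r)).toMultilinearMap.map_sum _).trans ?_
  refine Finset.sum_congr rfl fun f _ => ?_
  refine ((Matrix.detRowAlternating (R := A) (n := Fin r)).toMultilinearMap.map_smul_univ _ _).trans ?_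
  rw [smul_eq_mul, ← Matrix.det_transpose (M.submatrix id f)]
  rfl

/-- The Cauchy–Binet formula. -/
theorem det_mul_eq_sum_minors [Fintype c] (M : Matrix (Fin r) c A) (D : Matrix c (Fin r) A) :
    (M * D).det = ∑ S : PluckerIndex r c,
      (D.submatrix (pluckerEmb S) id).det * (M.submatrix id (pluckerEmb S)).det := by
  rw [det_mul_eq_sum_pi]
  have h : ∀ S : PluckerIndex r c,
      (D.submatrix (pluckerEmb S) id).det * (M.submatrix id (pluckerEmb S)).det =
      ∑ σ : Equiv.Perm (Fin r), (∏ j, D (pluckerEmb S (σ j)) j) *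
        (M.submatrix id (pluckerEmb S ∘ σ)).det := by
    intro S
    rw [Matrix.det_apply', Finset.sum_mul]
    refine Finset.sum_congr rfl fun σ _ => ?_
    have := Matrix.det_permute' σ (M.submatrix id (pluckerEmb S))
    rw [Matrix.submatrix_submatrix] at this
    rw [Function.id_comp] at this
    rw [this]
    simp only [Matrix.submatrix_apply, id_eq]
    ring
  simp_rw [h]
  rw [← Finset.sum_product', Finset.univ_product_univ]
  symm
  -- An injective `f` is, in exactly one way, the increasing enumeration of its image after a
  -- permutation; any other `f` repeats a column and contributes zero.
  refine Finset.sum_of_injOn (fun q => pluckerEmb q.1 ∘ q.2) ?_ (by simp) ?_ (fun _ _ => rfl)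
  · rintro ⟨S, σ⟩ - ⟨S', σ'⟩ - hq
    have hq : pluckerEmb S ∘ σ = pluckerEmb S' ∘ σ' := hq
    have hS : S = S' := by
      apply Subtype.ext
      rw [← Finset.coe_inj, ← range_pluckerEmb, ← range_pluckerEmb, ← σ.surjective.range_comp,
        hq, σ'.surjective.range_comp]
    subst hS
    have : σ = σ' := Equiv.ext fun j => pluckerEmb_injective S (congrFun hq j)
    rw [this]
  · intro f _ hf
    rw [mul_eq_zero_of_right]
    by_cases hinj : Function.Injective f
    · refine absurd ?_ hf
      let S : PluckerIndex r c := ⟨Finset.univ.image f, by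
        rw [Finset.card_image_of_injective _ hinj, Finset.card_univ, Fintype.card_fin]⟩
      have hmem : ∀ j, ∃ i, pluckerEmb S i = f j := fun j => by
        rw [← Set.mem_range, range_pluckerEmb]
        simp [S]
      choose τ hτ using hmem
      have hτinj : Function.Injective τ := fun i j hij => hinj (by rw [← hτ, ← hτ, hij])
      exact ⟨(S, Equiv.ofBijective τ (Finite.injective_iff_bijective.1 hτinj)), by simp, funext hτ⟩
    · obtain ⟨i, j, hij, hne⟩ := Function.not_injective_iff.1 hinj
      exact Matrix.det_zero_of_column_eq hne fun a => by simp [hij]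

theorem pluckerVector_eq (M : Matrix (Fin r) c ℂ) (S : PluckerIndex r c) :
    pluckerVector M S = (M.submatrix id (pluckerEmb S)).det := rfl

theorem pluckerVector_mul [Fintype c] (M : Matrix (Fin r) c ℂ) (D : Matrix c c ℂ)
    (S : PluckerIndex r c) :
    pluckerVector (M * D) S = ∑ S', minor D S' S * pluckerVector M S' := by
  rw [pluckerVector_eq, ← Matrix.submatrix_mul_equiv M D id (Equiv.refl c),
    det_mul_eq_sum_minors]
  rfl

theorem pluckerVector_mul_left (B : Matrix (Fin r) (Fin r) ℂ) [Fintype c] (M : Matrix (Fin r) c ℂ) :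
    pluckerVector (B * M) = B.det • pluckerVector M := by
  ext S
  rw [pluckerVector_eq, Matrix.submatrix_mul B M id id _ Function.bijective_id, Matrix.det_mul]
  rfl

theorem minor_mul [Fintype c] (D E : Matrix c c A) (S' S : PluckerIndex r c) :
    minor (D * E) S' S = ∑ T, minor E T S * minor D S' T := by
  rw [minor, Matrix.submatrix_mul D E _ id _ Function.bijective_id, det_mul_eq_sum_minors]
  rfl

theorem minor_one [DecidableEq c] (S' S : PluckerIndex r c) [Decidable (S = S')] :
    minor (1 : Matrix c c A) S' S = if S = S' then 1 else 0 := by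
  split_ifs with h
  · subst h
    rw [minor, Matrix.submatrix_one _ (pluckerEmb_injective S), Matrix.det_one]
  · have : ¬ S'.1 ⊆ S.1 := fun hsub =>
      h (Subtype.ext (Finset.eq_of_subset_of_card_le hsub (by rw [S.2, S'.2])).symm)
    obtain ⟨x, hx', hx⟩ := Finset.not_subset.1 this
    obtain ⟨i, rfl⟩ : x ∈ Set.range (pluckerEmb S') := by
      rw [range_pluckerEmb]
      exact hx'
    refine Matrix.det_eq_zero_of_row_eq_zero i fun j => Matrix.one_apply_ne fun hij => hx ?_
    rw [hij, ← Finset.mem_coe, ← range_pluckerEmb]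
    exact Set.mem_range_self j

/-- A matrix which respects a partition of its index set has only zero minors for rows and columns
which meet the parts differently. -/
theorem card_filter_eq_of_minor_ne_zero {D : Matrix c c A} {S' S : PluckerIndex r c}
    (h : minor D S' S ≠ 0) (p : c → Prop) [DecidablePred p]
    (hD : ∀ i j, D i j ≠ 0 → (p i ↔ p j)) : (S'.1.filter p).card = (S.1.filter p).card := by
  rw [minor, Matrix.det_apply'] at h
  -- A non-zero term of the Leibniz expansion matches columns with rows in the same part.
  obtain ⟨σ, -, hσ⟩ := Finset.exists_ne_zero_of_sum_ne_zero h
  have hj : ∀ j, p (pluckerEmb S' (σ j)) ↔ p (pluckerEmb S j) := fun j =>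
    hD _ _ fun h0 => hσ (mul_eq_zero_of_right _ (Finset.prod_eq_zero (Finset.mem_univ j) h0))
  rw [card_filter_pluckerIndex, card_filter_pluckerIndex]
  refine (Finset.card_equiv σ fun j => ?_).symm
  simp [hj]

end Minors

/-! ### The representation on bifocal tensors -/

section BlockDiagonal

variable {h₁ h₂ : ℕ} {A : Type*} [CommRing A]

/-- The block diagonal matrix of a pair of square matrices. -/
def blockDiag (B₁ : Matrix (Fin (h₁ + 1)) (Fin (h₁ + 1)) A)
    (B₂ : Matrix (Fin (h₂ + 1)) (Fin (h₂ + 1)) A) : Matrix (Cols h₁ h₂) (Cols h₁ h₂) A :=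
  (Matrix.fromBlocks B₁ 0 0 B₂).submatrix ofLex ofLex

variable (B₁ : Matrix (Fin (h₁ + 1)) (Fin (h₁ + 1)) A)
    (B₂ : Matrix (Fin (h₂ + 1)) (Fin (h₂ + 1)) A)

theorem blockDiag_mul (C₁ : Matrix (Fin (h₁ + 1)) (Fin (h₁ + 1)) A)
    (C₂ : Matrix (Fin (h₂ + 1)) (Fin (h₂ + 1)) A) :
    blockDiag (B₁ * C₁) (B₂ * C₂) = blockDiag B₁ B₂ * blockDiag C₁ C₂ := by
  have := Matrix.fromBlocks_multiply B₁ 0 0 B₂ C₁ 0 0 C₂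
  simp only [Matrix.mul_zero, Matrix.zero_mul, add_zero, zero_add] at this
  rw [blockDiag, ← this, Matrix.submatrix_mul _ _ _ _ _ ofLex.bijective]
  rfl

theorem blockDiag_one : blockDiag (1 : Matrix (Fin (h₁ + 1)) (Fin (h₁ + 1)) A)
    (1 : Matrix (Fin (h₂ + 1)) (Fin (h₂ + 1)) A) = 1 := by
  rw [blockDiag, Matrix.fromBlocks_one, Matrix.submatrix_one _ ofLex.injective]

variable {B₁ B₂} in
theorem isLeft_eq_of_blockDiag_ne_zero {i j : Cols h₁ h₂} (h : blockDiag B₁ B₂ i j ≠ 0) :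
    (ofLex i).isLeft = (ofLex j).isLeft ∧ (ofLex i).isRight = (ofLex j).isRight := by
  rw [blockDiag, Matrix.submatrix_apply] at h
  rcases hi : ofLex i with a | a <;> rcases hj : ofLex j with b | b <;> simp_all

variable {k α₁ α₂ : ℕ}

theorem profile_of_minor_blockDiag_ne_zero {S' S : PluckerIndex (k + 1) (Cols h₁ h₂)}
    (h : minor (blockDiag B₁ B₂) S' S ≠ 0) :
    (S'.1.filter fun c => (ofLex c).isLeft = true).card =
      (S.1.filter fun c => (ofLex c).isLeft = true).card ∧
    (S'.1.filter fun c => (ofLex c).isRight = true).card =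
      (S.1.filter fun c => (ofLex c).isRight = true).card :=
  ⟨card_filter_eq_of_minor_ne_zero h _ fun i j hij => by
      rw [(isLeft_eq_of_blockDiag_ne_zero hij).1],
    card_filter_eq_of_minor_ne_zero h _ fun i j hij => by
      rw [(isLeft_eq_of_blockDiag_ne_zero hij).2]⟩

/-- Block diagonal matrices preserve the summand of profile `(α₁, α₂)` of the exterior power, so the
action on Plücker vectors descends to tensors. -/
theorem sum_minor_blockDiag (S : TensorIndex k h₁ h₂ α₁ α₂)
    (F : PluckerIndex (k + 1) (Cols h₁ h₂) → A) :
    ∑ S', minor (blockDiag B₁ B₂) S' S.1 * F S' =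
      ∑ S' : TensorIndex k h₁ h₂ α₁ α₂, minor (blockDiag B₁ B₂) S'.1 S.1 * F S'.1 := by
  symm
  refine Finset.sum_of_injOn Subtype.val Subtype.val_injective.injOn (by simp) ?_ (fun _ _ => rfl)
  intro S' _ hS'
  by_contra h
  obtain ⟨h1, h2⟩ := profile_of_minor_blockDiag_ne_zero B₁ B₂ (left_ne_zero_of_mul h)
  exact hS' ⟨⟨S', h1.trans S.2.1, h2.trans S.2.2⟩, by simp, rfl⟩

/-- The matrix, with entries polynomial functions on the group, by which pairs of invertible matrices
act on bifocal tensors. -/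
noncomputable def tensorRep (k h₁ h₂ α₁ α₂ : ℕ) :
    Matrix (TensorIndex k h₁ h₂ α₁ α₂) (TensorIndex k h₁ h₂ α₁ α₂)
      (MvPolynomial ((Fin (h₁ + 1) × Fin (h₁ + 1)) ⊕ (Fin (h₂ + 1) × Fin (h₂ + 1))) ℂ) :=
  Matrix.of fun S S' => minor (blockDiag
    (Matrix.of fun i j => MvPolynomial.X (Sum.inl (i, j)))
    (Matrix.of fun i j => MvPolynomial.X (Sum.inr (i, j)))) S'.1 S.1

theorem map_minor {A' : Type*} [CommRing A'] (φ : A →+* A') {r : ℕ} {c : Type*} [LinearOrder c]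
    (D : Matrix c c A) (S' S : PluckerIndex r c) : φ (minor D S' S) = minor (D.map φ) S' S :=
  RingHom.map_det φ _

theorem specialize_tensorRep (g : GL (Fin (h₁ + 1)) ℂ × GL (Fin (h₂ + 1)) ℂ)
    (S S' : TensorIndex k h₁ h₂ α₁ α₂) :
    specialize (tensorRep k h₁ h₂ α₁ α₂) g S S' = minor (blockDiag g.1.1 g.2.1) S'.1 S.1 := by
  rw [specialize, Matrix.map_apply, tensorRep, Matrix.of_apply, map_minor]
  congr 1
  ext i j
  simp only [blockDiag, Matrix.map_apply, Matrix.submatrix_apply]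
  rcases ofLex i with a | a <;> rcases ofLex j with b | b <;> simp [entries]

/-- The action on pairs of matrices induces the linear action on bifocal tensors. -/
theorem bifocalTensor_moveCols
    (M : Matrix (Fin (k + 1)) (Fin (h₁ + 1)) ℂ × Matrix (Fin (k + 1)) (Fin (h₂ + 1)) ℂ)
    (g : GL (Fin (h₁ + 1)) ℂ × GL (Fin (h₂ + 1)) ℂ) :
    bifocalTensor α₁ α₂ (moveCols M g) =
      (specialize (tensorRep k h₁ h₂ α₁ α₂) g).mulVec (bifocalTensor α₁ α₂ M) := by
  have hj : joint (moveCols M g) = joint M * blockDiag g.1.1 g.2.1 := by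
    have := Matrix.fromCols_mul_fromBlocks M.1 M.2 g.1.1 0 0 g.2.1
    simp only [Matrix.mul_zero, add_zero, zero_add] at this
    rw [joint, moveCols, ← this, Matrix.submatrix_mul _ _ _ _ _ ofLex.bijective]
    rfl
  ext S
  change pluckerVector (joint (moveCols M g)) S.1 = _
  rw [hj, pluckerVector_mul, sum_minor_blockDiag]
  simp only [Matrix.mulVec, dotProduct, specialize_tensorRep]
  rfl

theorem bifocalTensor_mul_left (B : Matrix (Fin (k + 1)) (Fin (k + 1)) ℂ)
    (M : Matrix (Fin (k + 1)) (Fin (h₁ + 1)) ℂ × Matrix (Fin (k + 1)) (Fin (h₂ + 1)) ℂ) :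
    bifocalTensor α₁ α₂ (B * M.1, B * M.2) = B.det • bifocalTensor α₁ α₂ M := by
  have : joint (B * M.1, B * M.2) = B * joint M := by
    rw [joint, ← Matrix.mul_fromCols, Matrix.submatrix_mul _ _ _ id _ Function.bijective_id]
    rfl
  rw [bifocalTensor, this, pluckerVector_mul_left, map_smul]
  rfl

/-- Multiplicativity is Cauchy–Binet. For the homothety by `c`, scale the first block by an `α₁`-th
root `d` of `c`: each minor of the tensor uses exactly `α₁` columns of that block. -/
theorem isConicalRep_tensorRep (hα₁ : α₁ ≠ 0) : IsConicalRep (tensorRep k h₁ h₂ α₁ α₂) where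
  one := by
    ext S S'
    rw [specialize_tensorRep]
    have : blockDiag (1 : GL (Fin (h₁ + 1)) ℂ × GL (Fin (h₂ + 1)) ℂ).1.1
      (1 : GL (Fin (h₁ + 1)) ℂ × GL (Fin (h₂ + 1)) ℂ).2.1 = 1 := blockDiag_one
    rw [this, minor_one]
    by_cases h : S = S'
    · subst h
      exact (if_pos rfl).trans (Matrix.one_apply_eq S).symm
    · exact (if_neg (Subtype.ext_iff.not.1 h)).trans (Matrix.one_apply_ne h).symm
  mul g g' := by
    ext S S'
    rw [specialize_tensorRep]
    have : blockDiag (g * g').1.1 (g * g').2.1 =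
      blockDiag g.1.1 g.2.1 * blockDiag g'.1.1 g'.2.1 := blockDiag_mul _ _ _ _
    rw [this, minor_mul, sum_minor_blockDiag, Matrix.mul_apply]
    simp only [specialize_tensorRep]
  homothety c hc := by
    obtain ⟨d, hd⟩ := IsAlgClosed.exists_pow_nat_eq c (Nat.pos_of_ne_zero hα₁)
    have hd0 : d ≠ 0 := by
      rintro rfl
      exact hc (by rw [← hd, zero_pow hα₁])
    let s : Cols h₁ h₂ → ℂ := fun i => if (ofLex i).isLeft = true then d else 1
    refine ⟨(Matrix.GeneralLinearGroup.mkOfDetNeZero (d • 1) (by simp [hd0]), 1), ?_⟩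
    ext S S'
    rw [specialize_tensorRep]
    have hD : blockDiag (Matrix.GeneralLinearGroup.mkOfDetNeZero
        (d • (1 : Matrix (Fin (h₁ + 1)) (Fin (h₁ + 1)) ℂ)) (by simp [hd0])).1
        (1 : GL (Fin (h₂ + 1)) ℂ).1 =
        Matrix.of fun i j => s j * (1 : Matrix (Cols h₁ h₂) (Cols h₁ h₂) ℂ) i j := by
      rw [← blockDiag_one]
      ext i j
      simp only [blockDiag, Matrix.submatrix_apply, Matrix.of_apply, s]
      rcases ofLex i with a | a <;> rcases ofLex j with b | b <;>
        simp [Matrix.GeneralLinearGroup.mkOfDetNeZero]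
    have hprod : ∏ j, s (pluckerEmb S.1 j) = c := by
      have hcard := S.2.1
      rw [card_filter_pluckerIndex] at hcard
      simp [s, Finset.prod_ite, hcard, hd]
    have hm := Matrix.det_mul_row (fun j => s (pluckerEmb S.1 j))
      ((1 : Matrix (Cols h₁ h₂) (Cols h₁ h₂) ℂ).submatrix (pluckerEmb S'.1) (pluckerEmb S.1))
    rw [hprod] at hm
    have h1 := minor_one (A := ℂ) S'.1 S.1
    refine (congrArg (fun D => minor D S'.1 S.1) hD).trans (hm.trans ?_)
    rw [Matrix.smul_apply, smul_eq_mul]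
    refine congrArg (c * ·) (h1.trans ?_)
    by_cases h : S = S'
    · subst h
      exact (if_pos rfl).trans (Matrix.one_apply_eq S).symm
    · exact (if_neg (Subtype.ext_iff.not.1 h)).trans (Matrix.one_apply_ne h).symm

end BlockDiagonal

end Bifocal

/-! ### Linear algebra: pairs of embeddings that span -/

/-- Two embeddings of a vector space into a finite-dimensional one differ by an automorphism of the
latter. -/
theorem LinearMap.exists_linearEquiv_comp_eq {K E E' U : Type*} [Field K] [AddCommGroup E]
    [Module K E] [AddCommGroup E'] [Module K E'] [AddCommGroup U] [Module K U]
    [FiniteDimensional K U] {i : E →ₗ[K] U} {i' : E' →ₗ[K] U} (hi : Function.Injective i)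
    (hi' : Function.Injective i') (κ : E ≃ₗ[K] E') :
    ∃ e : U ≃ₗ[K] U, ∀ x, e (i x) = i' (κ x) := by
  obtain ⟨Q, hQ⟩ := Submodule.exists_isCompl (LinearMap.range i)
  obtain ⟨Q', hQ'⟩ := Submodule.exists_isCompl (LinearMap.range i')
  have h1 := Submodule.finrank_add_eq_of_isCompl hQ
  have h2 := Submodule.finrank_add_eq_of_isCompl hQ'
  rw [LinearMap.finrank_range_of_inj hi, κ.finrank_eq] at h1
  rw [LinearMap.finrank_range_of_inj hi'] at h2
  obtain ⟨φ⟩ := FiniteDimensional.nonempty_linearEquiv_of_finrank_eq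
    (Nat.add_left_cancel (h1.trans h2.symm))
  refine ⟨(Submodule.prodEquivOfIsCompl _ _ hQ).symm ≪≫ₗ
    (((LinearEquiv.ofInjective i hi).symm ≪≫ₗ κ ≪≫ₗ LinearEquiv.ofInjective i' hi').prodCongr φ) ≪≫ₗ
    Submodule.prodEquivOfIsCompl _ _ hQ', fun x => ?_⟩
  have hx : i x = (LinearEquiv.ofInjective i hi x : U) := rfl
  rw [hx]
  simp only [LinearEquiv.trans_apply]
  rw [Submodule.prodEquivOfIsCompl_symm_apply_left]
  simp

section Coprod

variable {K U₁ U₂ W : Type*} [Field K] [AddCommGroup U₁] [Module K U₁] [AddCommGroup U₂]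
  [Module K U₂] [AddCommGroup W] [Module K W] {f₁ g₁ : U₁ →ₗ[K] W} {f₂ g₂ : U₂ →ₗ[K] W}

/-- An element of the kernel with first component zero is killed by `f₂` in its second component. -/
theorem LinearMap.fst_ker_coprod_injective (h : Function.Injective f₂) :
    Function.Injective (LinearMap.fst K U₁ U₂ ∘ₗ (LinearMap.ker (f₁.coprod f₂)).subtype) := by
  refine (injective_iff_map_eq_zero _).2 fun z hz => ?_
  have h1 : z.1.1 = 0 := hz
  have h2 := LinearMap.mem_ker.1 z.2
  rw [LinearMap.coprod_apply, h1, map_zero, zero_add] at h2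
  exact Subtype.ext (Prod.ext h1 (h (h2.trans (map_zero f₂).symm)))

theorem LinearMap.snd_ker_coprod_injective (h : Function.Injective f₁) :
    Function.Injective (LinearMap.snd K U₁ U₂ ∘ₗ (LinearMap.ker (f₁.coprod f₂)).subtype) := by
  refine (injective_iff_map_eq_zero _).2 fun z hz => ?_
  have h1 : z.1.2 = 0 := hz
  have h2 := LinearMap.mem_ker.1 z.2
  rw [LinearMap.coprod_apply, h1, map_zero, add_zero] at h2
  exact Subtype.ext (Prod.ext (h (h2.trans (map_zero f₁).symm)) h1)

/-- A surjection `g` induces an automorphism of its target, finite-dimensional, if its kernel contains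
that of another surjection `f`. -/
theorem LinearMap.exists_linearEquiv_of_ker_le {V : Type*} [AddCommGroup V] [Module K V]
    [FiniteDimensional K W] {f g : V →ₗ[K] W} (hf : Function.Surjective f)
    (hg : Function.Surjective g) (h : LinearMap.ker f ≤ LinearMap.ker g) :
    ∃ e : W ≃ₗ[K] W, ∀ z, e (f z) = g z := by
  -- The automorphism is `g ∘ₗ s` for a section `s` of `f`; the inclusion of kernels gives `g ∘ₗ s
  -- ∘ₗ f = g`, and a surjective endomorphism in finite dimension is bijective.
  obtain ⟨s, hs⟩ := f.exists_rightInverse_of_surjective (LinearMap.range_eq_top.2 hf)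
  have hb : ∀ z, (g ∘ₗ s) (f z) = g z := by
    intro z
    have h1 : f (s (f z)) = f z := LinearMap.congr_fun hs (f z)
    have h0 : s (f z) - z ∈ LinearMap.ker g := h (by rw [LinearMap.mem_ker, map_sub, h1, sub_self])
    rw [LinearMap.mem_ker, map_sub, sub_eq_zero] at h0
    exact h0
  have hbs : Function.Surjective (g ∘ₗ s) := fun w => by
    obtain ⟨z, rfl⟩ := hg w
    exact ⟨f z, hb z⟩
  exact ⟨LinearEquiv.ofBijective (g ∘ₗ s) ⟨LinearMap.injective_iff_surjective.2 hbs, hbs⟩, hb⟩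

variable [FiniteDimensional K U₁] [FiniteDimensional K U₂]

/-- Subspaces of a product which are graphs over both factors are equivalent if they have the same
dimension. -/
theorem Submodule.exists_linearEquiv_prod {P Q : Submodule K (U₁ × U₂)}
    (hP₁ : Function.Injective (LinearMap.fst K U₁ U₂ ∘ₗ P.subtype))
    (hP₂ : Function.Injective (LinearMap.snd K U₁ U₂ ∘ₗ P.subtype))
    (hQ₁ : Function.Injective (LinearMap.fst K U₁ U₂ ∘ₗ Q.subtype))
    (hQ₂ : Function.Injective (LinearMap.snd K U₁ U₂ ∘ₗ Q.subtype))
    (h : Module.finrank K P = Module.finrank K Q) :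
    ∃ (e₁ : U₁ ≃ₗ[K] U₁) (e₂ : U₂ ≃ₗ[K] U₂), ∀ z ∈ P, (e₁ z.1, e₂ z.2) ∈ Q := by
  obtain ⟨κ⟩ := FiniteDimensional.nonempty_linearEquiv_of_finrank_eq h
  -- Both extensions start from the same `κ`, so on `P` the pair `(e₁, e₂)` is `κ` itself.
  obtain ⟨e₁, he₁⟩ := LinearMap.exists_linearEquiv_comp_eq hP₁ hQ₁ κ
  obtain ⟨e₂, he₂⟩ := LinearMap.exists_linearEquiv_comp_eq hP₂ hQ₂ κ
  refine ⟨e₁, e₂, fun z hz => ?_⟩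
  have h1 : e₁ z.1 = (κ ⟨z, hz⟩).1.1 := he₁ ⟨z, hz⟩
  have h2 : e₂ z.2 = (κ ⟨z, hz⟩).1.2 := he₂ ⟨z, hz⟩
  rw [h1, h2]
  exact (κ ⟨z, hz⟩).2

/-- Two pairs of embeddings into a vector space, of which each spans it, are equivalent. -/
theorem LinearMap.exists_linearEquiv_of_injective_of_surjective [FiniteDimensional K W]
    (hf₁ : Function.Injective f₁) (hf₂ : Function.Injective f₂)
    (hg₁ : Function.Injective g₁) (hg₂ : Function.Injective g₂)
    (hf : Function.Surjective (f₁.coprod f₂)) (hg : Function.Surjective (g₁.coprod g₂)) :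
    ∃ (e : W ≃ₗ[K] W) (e₁ : U₁ ≃ₗ[K] U₁) (e₂ : U₂ ≃ₗ[K] U₂),
      (∀ x, e (f₁ x) = g₁ (e₁ x)) ∧ ∀ y, e (f₂ y) = g₂ (e₂ y) := by
  have hdf := LinearMap.finrank_range_add_finrank_ker (f₁.coprod f₂)
  have hdg := LinearMap.finrank_range_add_finrank_ker (g₁.coprod g₂)
  rw [LinearMap.range_eq_top.2 hf] at hdf
  rw [LinearMap.range_eq_top.2 hg] at hdg
  obtain ⟨e₁, e₂, hE⟩ := Submodule.exists_linearEquiv_prod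
    (LinearMap.fst_ker_coprod_injective hf₂) (LinearMap.snd_ker_coprod_injective hf₁)
    (LinearMap.fst_ker_coprod_injective hg₂) (LinearMap.snd_ker_coprod_injective hg₁)
    (Nat.add_left_cancel (hdf.trans hdg.symm))
  obtain ⟨e, he⟩ := LinearMap.exists_linearEquiv_of_ker_le hf
    (g := g₁.coprod g₂ ∘ₗ (e₁.prodCongr e₂).toLinearMap)
    (hg.comp (e₁.prodCongr e₂).surjective) hE
  refine ⟨e, e₁, e₂, fun x => ?_, fun y => ?_⟩
  · simpa using he (x, 0)
  · simpa using he (0, y)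

end Coprod

theorem Matrix.mulVecLin_injective_of_rank_eq {K m : Type*} {n : ℕ} [Field K] [Fintype m]
    {A : Matrix m (Fin n) K} (h : A.rank = n) : Function.Injective A.mulVecLin := by
  have hd := LinearMap.finrank_range_add_finrank_ker A.mulVecLin
  rw [Module.finrank_fin_fun] at hd
  rw [← LinearMap.ker_eq_bot, ← Submodule.finrank_eq_zero (R := K)]
  rw [Matrix.rank] at h
  omega

/-- Columns span if no non-zero vector is orthogonal to all of them. -/
theorem Matrix.coprod_mulVecLin_surjective {K n₁ n₂ : Type*} {r : ℕ} [Field K] [Fintype n₁]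
    [Fintype n₂] {A : Matrix (Fin r) n₁ K} {B : Matrix (Fin r) n₂ K}
    (h : LinearMap.ker A.transpose.mulVecLin ⊓ LinearMap.ker B.transpose.mulVecLin = ⊥) :
    Function.Surjective (A.mulVecLin.coprod B.mulVecLin) := by
  have hker : LinearMap.ker (Matrix.fromCols A B).transpose.mulVecLin = ⊥ := by
    rw [← h]
    ext x
    rw [Matrix.transpose_fromCols, LinearMap.mem_ker, Matrix.mulVecLin_apply,
      Matrix.fromRows_mulVec, Submodule.mem_inf, LinearMap.mem_ker, LinearMap.mem_ker]
    constructor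
    · intro hx
      exact ⟨funext fun i => congrFun hx (Sum.inl i), funext fun i => congrFun hx (Sum.inr i)⟩
    · rintro ⟨h1, h2⟩
      ext (i | i)
      · exact congrFun h1 i
      · exact congrFun h2 i
  have hd := LinearMap.finrank_range_add_finrank_ker (Matrix.fromCols A B).transpose.mulVecLin
  rw [hker, finrank_bot, add_zero, Module.finrank_fin_fun] at hd
  have hr : (Matrix.fromCols A B).rank = r := by rw [← Matrix.rank_transpose]; exact hd
  have htop : LinearMap.range (Matrix.fromCols A B).mulVecLin = ⊤ := by
    apply Submodule.eq_top_of_finrank_eq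
    rw [Module.finrank_fin_fun]
    exact hr
  intro w
  obtain ⟨x, hx⟩ := LinearMap.range_eq_top.1 htop w
  refine ⟨(x ∘ Sum.inl, x ∘ Sum.inr), ?_⟩
  rw [← hx, Matrix.mulVecLin_apply, Matrix.fromCols_mulVec]
  rfl

/-! ### All bifocal tensors lie in one orbit -/

namespace Bifocal

variable {k h₁ h₂ : ℕ}

/-- Any two pairs of projections are equivalent under changes of coordinates. -/
theorem exists_mul_eq_moveCols
    {M N : Matrix (Fin (k + 1)) (Fin (h₁ + 1)) ℂ × Matrix (Fin (k + 1)) (Fin (h₂ + 1)) ℂ}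
    (hM : M ∈ projectionPairs k h₁ h₂) (hN : N ∈ projectionPairs k h₁ h₂) :
    ∃ (B : Matrix (Fin (k + 1)) (Fin (k + 1)) ℂ) (g : GL (Fin (h₁ + 1)) ℂ × GL (Fin (h₂ + 1)) ℂ),
      B.det ≠ 0 ∧ (B * M.1, B * M.2) = moveCols N g := by
  obtain ⟨e, e₁, e₂, h1, h2⟩ := LinearMap.exists_linearEquiv_of_injective_of_surjective
    (Matrix.mulVecLin_injective_of_rank_eq hM.1) (Matrix.mulVecLin_injective_of_rank_eq hM.2.1)
    (Matrix.mulVecLin_injective_of_rank_eq hN.1) (Matrix.mulVecLin_injective_of_rank_eq hN.2.1)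
    (Matrix.coprod_mulVecLin_surjective hM.2.2) (Matrix.coprod_mulVecLin_surjective hN.2.2)
  have hdet : ∀ {n : ℕ} (a : (Fin n → ℂ) ≃ₗ[ℂ] (Fin n → ℂ)),
      (LinearMap.toMatrix' a.toLinearMap).det ≠ 0 := fun a => by
    rw [LinearMap.det_toMatrix']
    exact a.isUnit_det'.ne_zero
  refine ⟨LinearMap.toMatrix' e.toLinearMap,
    (Matrix.GeneralLinearGroup.mkOfDetNeZero _ (hdet e₁),
      Matrix.GeneralLinearGroup.mkOfDetNeZero _ (hdet e₂)), hdet e, Prod.ext ?_ ?_⟩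
  · refine Matrix.toLin'.injective (LinearMap.ext fun x => ?_)
    change Matrix.toLin' (LinearMap.toMatrix' e.toLinearMap * M.1) x =
      Matrix.toLin' (N.1 * LinearMap.toMatrix' e₁.toLinearMap) x
    rw [Matrix.toLin'_mul, Matrix.toLin'_mul, Matrix.toLin'_toMatrix', Matrix.toLin'_toMatrix']
    exact h1 x
  · refine Matrix.toLin'.injective (LinearMap.ext fun x => ?_)
    change Matrix.toLin' (LinearMap.toMatrix' e.toLinearMap * M.2) x =
      Matrix.toLin' (N.2 * LinearMap.toMatrix' e₂.toLinearMap) x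
    rw [Matrix.toLin'_mul, Matrix.toLin'_mul, Matrix.toLin'_toMatrix', Matrix.toLin'_toMatrix']
    exact h2 x

theorem moveCols_mem_projectionPairs
    {M : Matrix (Fin (k + 1)) (Fin (h₁ + 1)) ℂ × Matrix (Fin (k + 1)) (Fin (h₂ + 1)) ℂ}
    (hM : M ∈ projectionPairs k h₁ h₂) (g : GL (Fin (h₁ + 1)) ℂ × GL (Fin (h₂ + 1)) ℂ) :
    moveCols M g ∈ projectionPairs k h₁ h₂ := by
  have hker : ∀ {n : ℕ} (A : Matrix (Fin (k + 1)) (Fin n) ℂ) (H : GL (Fin n) ℂ),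
      LinearMap.ker (A * H.1).transpose.mulVecLin = LinearMap.ker A.transpose.mulVecLin := by
    intro n A H
    ext x
    rw [LinearMap.mem_ker, LinearMap.mem_ker, Matrix.mulVecLin_apply, Matrix.mulVecLin_apply,
      Matrix.transpose_mul, ← Matrix.mulVec_mulVec]
    constructor
    · intro h
      have hu : IsUnit H.1.transpose := (Matrix.isUnit_transpose H.1).2 H.isUnit
      exact Matrix.mulVec_injective_of_isUnit hu (by rw [h, Matrix.mulVec_zero])
    · intro h
      rw [h, Matrix.mulVec_zero]
  have hrank : ∀ {n : ℕ} (A : Matrix (Fin (k + 1)) (Fin n) ℂ) (H : GL (Fin n) ℂ),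
      (A * H.1).rank = A.rank := fun A H =>
    Matrix.rank_mul_eq_left_of_isUnit_det H.1 A ((Matrix.isUnit_iff_isUnit_det _).1 H.isUnit)
  refine ⟨(hrank _ _).trans hM.1, (hrank _ _).trans hM.2.1, ?_⟩
  rw [moveCols, hker, hker]
  exact hM.2.2

theorem rank_one_submatrix {K : Type*} [Field K] {r n : ℕ} {f : Fin n → Fin r}
    (hf : Function.Injective f) : ((1 : Matrix (Fin r) (Fin r) K).submatrix id f).rank = n := by
  refine le_antisymm ((Matrix.rank_le_card_width _).trans_eq (Fintype.card_fin n)) ?_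
  have h : ((1 : Matrix (Fin r) (Fin r) K).submatrix id f).transpose *
      (1 : Matrix (Fin r) (Fin r) K).submatrix id f = 1 := by
    rw [Matrix.transpose_submatrix, Matrix.transpose_one,
      ← Matrix.submatrix_mul _ _ _ id _ Function.bijective_id, Matrix.one_mul,
      Matrix.submatrix_one _ hf]
  have := Matrix.rank_mul_le_right ((1 : Matrix (Fin r) (Fin r) K).submatrix id f).transpose
    ((1 : Matrix (Fin r) (Fin r) K).submatrix id f)
  rwa [h, Matrix.rank_one, Fintype.card_fin] at this

/-- There is a pair of projections whose bifocal tensor is not zero. -/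
theorem exists_bifocalTensor_ne_zero {α₁ α₂ : ℕ} (hk₁ : h₁ < k) (hk₂ : h₂ < k)
    (hα : α₁ + α₂ = k + 1) (hα₁ : α₁ ≤ h₁) (hα₂ : α₂ ≤ h₂) :
    ∃ M ∈ projectionPairs k h₁ h₂, bifocalTensor α₁ α₂ M ≠ 0 := by
  -- The two projections keep the first `h₁ + 1` and the last `h₂ + 1` coordinates. Together these
  -- are all coordinates, because `k + 1 = α₁ + α₂ ≤ h₁ + h₂`.
  let f₁ : Fin (h₁ + 1) → Fin (k + 1) := fun j => ⟨j, by omega⟩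
  let f₂ : Fin (h₂ + 1) → Fin (k + 1) := fun j => ⟨j + (k - h₂), by omega⟩
  have hf₁ : Function.Injective f₁ := fun i j h => Fin.ext (by simpa [f₁] using h)
  have hf₂ : Function.Injective f₂ := fun i j h => Fin.ext (by simpa [f₂] using h)
  let f : Cols h₁ h₂ → Fin (k + 1) := fun c => Sum.elim f₁ f₂ (ofLex c)
  let M : Matrix (Fin (k + 1)) (Fin (h₁ + 1)) ℂ × Matrix (Fin (k + 1)) (Fin (h₂ + 1)) ℂ :=
    ((1 : Matrix _ _ ℂ).submatrix id f₁, (1 : Matrix _ _ ℂ).submatrix id f₂)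
  have hjoint : joint M = (1 : Matrix (Fin (k + 1)) (Fin (k + 1)) ℂ).submatrix id f := by
    ext i c
    simp only [joint, M, f, Matrix.submatrix_apply]
    rcases ofLex c with a | a <;> rfl
  refine ⟨M, ⟨rank_one_submatrix hf₁, rank_one_submatrix hf₂, ?_⟩, ?_⟩
  · rw [eq_bot_iff]
    rintro x ⟨hx1, hx2⟩
    have h1 : ∀ j, x (f₁ j) = 0 := fun j => by
      have := congrFun (LinearMap.mem_ker.1 hx1) j
      simpa [M, Matrix.mulVec, dotProduct, Matrix.one_apply] using this
    have h2 : ∀ j, x (f₂ j) = 0 := fun j => by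
      have := congrFun (LinearMap.mem_ker.1 hx2) j
      simpa [M, Matrix.mulVec, dotProduct, Matrix.one_apply] using this
    rw [Submodule.mem_bot]
    ext i
    by_cases hi : i.1 < h₁ + 1
    · exact h1 ⟨i, hi⟩
    · have := h2 ⟨i - (k - h₂), by omega⟩
      have hi' : f₂ ⟨i - (k - h₂), by omega⟩ = i := Fin.ext (by simp only [f₂]; omega)
      rwa [hi'] at this
  -- For each `i` a column equal to the `i`-th unit vector is chosen, in the first block exactly for
  -- the first `α₁` values. The subtraction is not truncated, since `α₂ ≤ h₂` gives `k - h₂ < α₁`.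
  · let e : Fin (k + 1) → Cols h₁ h₂ := fun i =>
      if h : i.1 < α₁ then toLex (Sum.inl ⟨i, by omega⟩)
      else toLex (Sum.inr ⟨i - (k - h₂), by omega⟩)
    have hfe : ∀ i, f (e i) = i := by
      intro i
      by_cases h : i.1 < α₁
      · simp [e, f, h, f₁]
      · simp only [e, f, h, f₂, dite_false, ofLex_toLex, Sum.elim_inr]
        exact Fin.ext (by simp only; omega)
    have hleft : ∀ i, (ofLex (e i)).isLeft = true ↔ i.1 < α₁ := by
      intro i
      by_cases h : i.1 < α₁ <;> simp [e, h]
    have hright : ∀ i, (ofLex (e i)).isRight = true ↔ ¬ i.1 < α₁ := by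
      intro i
      by_cases h : i.1 < α₁ <;> simp [e, h]
    have hinj : Function.Injective e := Function.LeftInverse.injective hfe
    have hcard : (Finset.univ.filter fun i : Fin (k + 1) => i.1 < α₁).card = α₁ := by
      rw [Fin.card_filter_val_lt]
      omega
    have hcard' : (Finset.univ.filter fun i : Fin (k + 1) => ¬ i.1 < α₁).card = α₂ := by
      have := Finset.card_filter_add_card_filter_not (s := (Finset.univ : Finset (Fin (k + 1))))
        (fun i => i.1 < α₁)
      rw [hcard, Finset.card_univ, Fintype.card_fin] at this
      omega
    let S : TensorIndex k h₁ h₂ α₁ α₂ := ⟨⟨Finset.univ.image e, by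
      rw [Finset.card_image_of_injective _ hinj, Finset.card_univ, Fintype.card_fin]⟩, by
      rw [Finset.filter_image, Finset.card_image_of_injective _ hinj]
      simp only [hleft, hcard], by
      rw [Finset.filter_image, Finset.card_image_of_injective _ hinj]
      simp only [hright, hcard']⟩
    have hmem : ∀ j, ∃ i, e i = pluckerEmb S.1 j := fun j => by
      have : pluckerEmb S.1 j ∈ (S.1.1 : Set (Cols h₁ h₂)) := by
        rw [← range_pluckerEmb]
        exact Set.mem_range_self j
      simpa [S] using this
    have hσ : Function.Injective (f ∘ pluckerEmb S.1) := by
      intro a b hab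
      obtain ⟨i, hi⟩ := hmem a
      obtain ⟨j, hj⟩ := hmem b
      rw [Function.comp_apply, Function.comp_apply, ← hi, ← hj, hfe, hfe] at hab
      exact pluckerEmb_injective S.1 (by rw [← hi, ← hj, hab])
    -- The chosen columns form a permutation matrix, so the minor is the sign of `σ`.
    let σ : Equiv.Perm (Fin (k + 1)) :=
      Equiv.ofBijective _ (Finite.injective_iff_bijective.1 hσ)
    intro h0
    have hS : bifocalTensor α₁ α₂ M S = 0 := congrFun h0 S
    change pluckerVector (joint M) S.1 = 0 at hS
    rw [pluckerVector_eq, hjoint, Matrix.submatrix_submatrix] at hS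
    have := Matrix.det_permute' σ (1 : Matrix (Fin (k + 1)) (Fin (k + 1)) ℂ)
    rw [Matrix.det_one, mul_one] at this
    have h1 : ((Equiv.Perm.sign σ : ℤ) : ℂ) = 0 := this.symm.trans hS
    rcases Int.units_eq_one_or (Equiv.Perm.sign σ) with h | h <;> simp [h] at h1

/-- Bifocal tensors of two pairs of projections lie in the same orbit. -/
theorem exists_span_bifocalTensor_eq {α₁ α₂ : ℕ}
    {M N : Matrix (Fin (k + 1)) (Fin (h₁ + 1)) ℂ × Matrix (Fin (k + 1)) (Fin (h₂ + 1)) ℂ}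
    (hM : M ∈ projectionPairs k h₁ h₂) (hN : N ∈ projectionPairs k h₁ h₂) :
    ∃ g : GL (Fin (h₁ + 1)) ℂ × GL (Fin (h₂ + 1)) ℂ,
      Submodule.span ℂ {bifocalTensor α₁ α₂ M} =
        Submodule.span ℂ {(specialize (tensorRep k h₁ h₂ α₁ α₂) g).mulVec
          (bifocalTensor α₁ α₂ N)} := by
  obtain ⟨B, g, hB, h⟩ := exists_mul_eq_moveCols hM hN
  refine ⟨g, ?_⟩
  rw [← bifocalTensor_moveCols, ← h, bifocalTensor_mul_left]
  exact (Submodule.span_singleton_smul_eq hB.isUnit _).symm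

/-- The bifocal variety is the closure of the orbit of any non-zero bifocal tensor. -/
theorem bifocalVariety_eq_closure_projectiveOrbit {α₁ α₂ : ℕ}
    (hR : IsConicalRep (tensorRep k h₁ h₂ α₁ α₂))
    {N : Matrix (Fin (k + 1)) (Fin (h₁ + 1)) ℂ × Matrix (Fin (k + 1)) (Fin (h₂ + 1)) ℂ}
    (hN : N ∈ projectionPairs k h₁ h₂) (hT : bifocalTensor α₁ α₂ N ≠ 0) :
    bifocalVariety k h₁ h₂ α₁ α₂ =
      closure (projectiveOrbit (tensorRep k h₁ h₂ α₁ α₂) (bifocalTensor α₁ α₂ N)) := by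
  have hspan : ∀ M : Matrix (Fin (k + 1)) (Fin (h₁ + 1)) ℂ × Matrix (Fin (k + 1)) (Fin (h₂ + 1)) ℂ,
      (Submodule.span ℂ {pluckerVector (joint M)}).map (tensorProjection k h₁ h₂ α₁ α₂) =
        Submodule.span ℂ {bifocalTensor α₁ α₂ M} := fun M => by
    rw [Submodule.map_span, Set.image_singleton]
    rfl
  rw [bifocalVariety]
  congr 1
  ext q
  constructor
  · rintro ⟨p, ⟨M, hM, hp⟩, hq⟩
    obtain ⟨g, hg⟩ := exists_span_bifocalTensor_eq (α₁ := α₁) (α₂ := α₂) hM hN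
    exact ⟨g, by rw [hq, hp, hspan, hg]⟩
  · rintro ⟨g, hg⟩
    rw [← bifocalTensor_moveCols] at hg
    -- The Plücker vector spans a point of the projective space because even its projection, the
    -- tensor, is non-zero.
    have hne : pluckerVector (joint (moveCols N g)) ≠ 0 := by
      intro h0
      have h1 : bifocalTensor α₁ α₂ (moveCols N g) = 0 := by
        rw [bifocalTensor, h0, map_zero]
      rw [bifocalTensor_moveCols] at h1
      exact hT (hR.mulVec_injective g (by simpa using h1))
    refine ⟨Projectivization.mk ℂ _ hne, ⟨_, moveCols_mem_projectionPairs hN g,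
      Projectivization.submodule_mk _ _⟩, ?_⟩
    rw [hg, Projectivization.submodule_mk, hspan]

end Bifocal

theorem theorem1 (k h₁ h₂ α₁ α₂ : ℕ) (hk₁ : h₁ < k) (hk₂ : h₂ < k)
    (hα : α₁ + α₂ = k + 1) (hα₁ : 1 ≤ α₁) (hα₁' : α₁ ≤ h₁) (hα₂ : 1 ≤ α₂) (hα₂' : α₂ ≤ h₂) :
    ∃ (Y : Set (ℙ ℂ (Bifocal.TensorIndex k h₁ h₂ α₁ α₂ → ℂ)))
      (act : ℙ ℂ (Bifocal.TensorIndex k h₁ h₂ α₁ α₂ → ℂ) →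
        GL (Fin (h₁ + 1)) ℂ × GL (Fin (h₂ + 1)) ℂ →
        ℙ ℂ (Bifocal.TensorIndex k h₁ h₂ α₁ α₂ → ℂ)),
      Bifocal.IsHomogeneousSpace Y act ∧
      Bifocal.Birational (Bifocal.bifocalVariety k h₁ h₂ α₁ α₂) Y ∧
      Bifocal.IsOpenSubsetOf Y (Bifocal.bifocalVariety k h₁ h₂ α₁ α₂) ∧
      ∀ M ∈ Bifocal.projectionPairs k h₁ h₂, ∀ H : GL (Fin (h₁ + 1)) ℂ × GL (Fin (h₂ + 1)) ℂ,
        ∃ y ∈ Y, y.submodule = Submodule.span ℂ {Bifocal.bifocalTensor α₁ α₂ M} ∧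
          (act y H).submodule =
            Submodule.span ℂ {Bifocal.bifocalTensor α₁ α₂ (Bifocal.moveCols M H)} := by
  have hR := Bifocal.isConicalRep_tensorRep (k := k) (h₁ := h₁) (h₂ := h₂) (α₂ := α₂)
    (Nat.one_le_iff_ne_zero.1 hα₁)
  obtain ⟨N, hN, hT⟩ := Bifocal.exists_bifocalTensor_ne_zero hk₁ hk₂ hα hα₁' hα₂'
  have hY := Bifocal.isHomogeneousSpace_projectiveOrbit hR hT
  have hopen := Bifocal.isOpenSubsetOf_closure_projectiveOrbit hR (Bifocal.bifocalTensor α₁ α₂ N)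
  rw [← Bifocal.bifocalVariety_eq_closure_projectiveOrbit hR hN hT] at hopen
  have hX : Bifocal.IsVariety (Bifocal.bifocalVariety k h₁ h₂ α₁ α₂) := by
    rw [Bifocal.bifocalVariety_eq_closure_projectiveOrbit hR hN hT]
    exact ⟨hY.variety.1.closure, isClosed_closure.isLocallyClosed⟩
  refine ⟨_, Bifocal.projectiveAction hR, hY,
    Bifocal.birational_of_isOpenSubsetOf hX hY.variety hopen, hopen, fun M hM H => ?_⟩
  -- The tensor of `M` spans the same line as a translate of that of `N`; hence it is non-zero too,
  -- and its point lies in the orbit.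
  obtain ⟨g, hg⟩ := Bifocal.exists_span_bifocalTensor_eq (α₁ := α₁) (α₂ := α₂) hM hN
  have hne : (Bifocal.specialize (Bifocal.tensorRep k h₁ h₂ α₁ α₂) g).mulVec
      (Bifocal.bifocalTensor α₁ α₂ N) ≠ 0 := fun h0 =>
    hT (hR.mulVec_injective g (by simpa using h0))
  have hy : (Projectivization.mk ℂ _ hne).submodule =
      Submodule.span ℂ {Bifocal.bifocalTensor α₁ α₂ M} := by
    rw [Projectivization.submodule_mk, hg]
  refine ⟨Projectivization.mk ℂ _ hne, ⟨g, Projectivization.submodule_mk _ _⟩, hy, ?_⟩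
  rw [Bifocal.projectiveAction_submodule hR hy, Bifocal.bifocalTensor_moveCols]
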